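/- Let $\mathbb F$ be a field of characteristic $0$, let $\eta\in\mathbb F\setminus\{0,1\}$ and let $m\ge 2$. Let $V$ be a $2m$-dimensional vector space over $\mathbb F_2$ with a nondegenerate alternating form $(\cdot,\cdot)$, let $G=Sp_{2m}(2)$ be its isometry group, and let $D$ be the class of transvections $r_v:u\mapsto u+(u,v)v$, $0\ne v\in V$, so that $(G,D)$ is a $3$-transposition group. Let $M=M_\eta(G,D)$ be the Matsuo algebra: the commutative $\mathbb F$-algebra with basis $D$ and, for $c,d\in D$, product $cd=c$ if $c=d$; $cd=0$ if $c,d$ are distinct and commute in $G$; $cd=\frac{\eta}{2}(c+d-c^d)$ if the group product of $c$ and $d$ has order $3$. Let $(\cdot,\cdot)_M$ be its Frobenius form, with $(c,d)_M=1,\ 0,\ \frac{\eta}{2}$ in these three cases, respectively. Let $e_1,\dots,e_m$ be a basis of a maximal totally isotropic subspace of $V$, let $\tau_m=r_{e_1}r_{e_2}\cdots r_{e_m}\in G$, and let $\sigma$ be the flip $\tau_m$, that is, the automorphism of order $2$ of $(G,D)$, and hence of $M$, given by conjugation with $\tau_m$. It is of type $1$ and rank $m$, that is, $\{v\in V:(v,\tau_m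 v)=0\}$ is a hyperplane of $V$ and $\dim[V,\tau_m]=m$. Let $A=A(\sigma)$ be the flip subalgebra: the subalgebra of $M$ generated by all singles ($c\in D$ with $c^\sigma=c$) and all doubles ($c+c^\sigma$ with $c\in D$, $c^\sigma\neq c$ and $cc^\sigma=0$ in $M$). Let $R(A)=\{u\in A:(u,v)_M=0\text{ for all }v\in A\}$ be the radical of $A$. (If $\eta\ne\frac12$, then $R(A)$ is also the largest ideal of $A$ that contains no single and no double.) **Theorem.** $R(A)\neq 0$ if and only if $\eta=-\frac{1}{2^{2m-3}}$, or $\eta=-\frac1{2^{m-2}}$ and $m\neq 2$, or $\eta=\frac{1}{2^{m-2}}$. Moreover, * if $\eta=-\frac{1}{2^{2m-3}}$, then $\dim R(A)=1$; * if $\eta=-\frac{1}{2^{m-2}}$, then $\dim R(A)=2^{2m-4}-2^{m-3}-1$ for $m$ odd and $\dim R(A)=2^{2m-4}-1$ for $m$ even (which is $0$ for $m=2$); * if $\eta=\frac{1}{2^{m-2}}$ (which forces $m\ge 3$, as $\eta\ne1$), then $\dim R(A)=2^{2m-4}+3\cdot 2^{m-3}-1$ for $m$ odd and $\dim R(A)=2^{2m-4}+2^{m-1}-1$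 for $m$ even. -/

import Mathlib

open Module

/-! ### 3-transposition groups -/

/-- A 3-transposition group `(G, D)`: `D` is a normal subset of `G` generating `G`, consisting of
elements of order `2`, such that all products `d * e` with `d, e ∈ D` have (finite) order at
most `3`. -/
structure ThreeTranspositionGroup (G : Type*) [Group G] where
  /-- the class of 3-transpositions -/
  D : Set G
  conj_mem : ∀ g : G, ∀ d ∈ D, g⁻¹ * d * g ∈ D
  closure_eq_top : Subgroup.closure D = ⊤
  orderOf_eq_two : ∀ d ∈ D, orderOf d = 2
  orderOf_mul_mem : ∀ d ∈ D, ∀ e ∈ D, orderOf (d * e) ∈ Set.Icc 1 3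

namespace ThreeTranspositionGroup

variable {G : Type*} [Group G] (T : ThreeTranspositionGroup G)

/-- The conjugate `c ^ d = d⁻¹ c d` of two 3-transpositions. -/
def conj (c d : T.D) : T.D := ⟨(d : G)⁻¹ * c * d, T.conj_mem d c c.2⟩

/-- A flip of `(G, D)`: an automorphism of `G` of order `2` that preserves `D`. -/
structure Flip where
  toMulAut : MulAut G
  image_eq : toMulAut '' T.D = T.D
  orderOf_eq_two : orderOf toMulAut = 2

variable {T} in
/-- The action of a flip on the points `D`. -/
def Flip.act (σ : T.Flip) (c : T.D) : T.D :=
  ⟨σ.toMulAut c, σ.image_eq.subset (Set.mem_image_of_mem _ c.2)⟩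

end ThreeTranspositionGroup

/-! ### Matsuo algebras -/

/-- The underlying space of the Matsuo algebra `M_η(G, D)`: the `F`-vector space with basis `D`.
The parameter `η` enters only through the product defined below. -/
@[nolint unusedArguments]
def MatsuoAlgebra {F : Type*} [Field F] (_η : F) {G : Type*} [Group G]
    (T : ThreeTranspositionGroup G) : Type _ := T.D →₀ F

namespace MatsuoAlgebra

variable {F : Type*} [Field F] (η : F) {G : Type*} [Group G] (T : ThreeTranspositionGroup G)

noncomputable instance : AddCommGroup (MatsuoAlgebra η T) :=
  inferInstanceAs (AddCommGroup (T.D →₀ F))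

noncomputable instance : Module F (MatsuoAlgebra η T) :=
  inferInstanceAs (Module F (T.D →₀ F))

variable {T} in
/-- The basis vector (axis) of `M_η(G, D)` given by a point `c ∈ D`. -/
noncomputable def axis (c : T.D) : MatsuoAlgebra η T := (Finsupp.single c 1 : T.D →₀ F)

open Classical in
variable {T} in
/-- The product of two basis vectors. -/
noncomputable def axisMul (c d : T.D) : MatsuoAlgebra η T :=
  if c = d then axis η c
  else if orderOf ((c : G) * d) = 2 then 0
  else (η / 2) • (axis η c + axis η d - axis η (T.conj c d))

/-- The bilinear extension of the product of basis vectors. -/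
noncomputable def mulLin : MatsuoAlgebra η T →ₗ[F] MatsuoAlgebra η T →ₗ[F] MatsuoAlgebra η T :=
  Finsupp.linearCombination F fun c : T.D =>
    (Finsupp.linearCombination F fun d : T.D => axisMul η c d :
      MatsuoAlgebra η T →ₗ[F] MatsuoAlgebra η T)

noncomputable instance : NonUnitalNonAssocRing (MatsuoAlgebra η T) :=
  { (inferInstance : AddCommGroup (MatsuoAlgebra η T)) with
    mul := fun x y => mulLin η T x y
    left_distrib := fun x y z => map_add (mulLin η T x) y z
    right_distrib := fun x y z => by
      change mulLin η T (x + y) z = mulLin η T x z + mulLin η T y z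
      rw [map_add, LinearMap.add_apply]
    zero_mul := fun x => by
      change mulLin η T 0 x = 0
      rw [map_zero, LinearMap.zero_apply]
    mul_zero := fun x => map_zero (mulLin η T x) }

instance : IsScalarTower F (MatsuoAlgebra η T) (MatsuoAlgebra η T) where
  smul_assoc r x y := by
    change mulLin η T (r • x) y = r • mulLin η T x y
    rw [map_smul, LinearMap.smul_apply]

instance : SMulCommClass F (MatsuoAlgebra η T) (MatsuoAlgebra η T) where
  smul_comm r x y := by
    change r • mulLin η T x y = mulLin η T x (r • y)
    rw [map_smul]

open Classical in
variable {T} in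
/-- The value of the Frobenius form on two basis vectors. -/
noncomputable def axisForm (c d : T.D) : F :=
  if c = d then 1 else if orderOf ((c : G) * d) = 2 then 0 else η / 2

/-- The Frobenius form of the Matsuo algebra. -/
noncomputable def form : LinearMap.BilinForm F (MatsuoAlgebra η T) :=
  Finsupp.linearCombination F fun c : T.D =>
    (Finsupp.linearCombination F fun d : T.D => axisForm η c d :
      MatsuoAlgebra η T →ₗ[F] F)

/-- The radical `R(U) = U ∩ Uᗮ` of a subspace `U` with respect to the Frobenius form. -/
noncomputable def radical (U : Submodule F (MatsuoAlgebra η T)) :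
    Submodule F (MatsuoAlgebra η T) :=
  U ⊓ (form η T).orthogonal U

variable {T} in
/-- The singles of a flip: the axes fixed by it. -/
def singles (σ : T.Flip) : Set (MatsuoAlgebra η T) :=
  {x | ∃ c : T.D, σ.act c = c ∧ x = axis η c}

variable {T} in
/-- The doubles of a flip: the sums `c + c^σ` over the orbits `{c, c^σ}` of length two with
`c * c^σ = 0` in the algebra. -/
def doubles (σ : T.Flip) : Set (MatsuoAlgebra η T) :=
  {x | ∃ c : T.D, σ.act c ≠ c ∧ axis η c * axis η (σ.act c) = 0 ∧
    x = axis η c + axis η (σ.act c)}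

variable {T} in
/-- The flip subalgebra `A(σ)`: the subalgebra generated by all singles and doubles. -/
noncomputable def flipSubalgebra (σ : T.Flip) : NonUnitalSubalgebra F (MatsuoAlgebra η T) :=
  NonUnitalAlgebra.adjoin F (singles η σ ∪ doubles η σ)

end MatsuoAlgebra

/-- `I` is an ideal of the subalgebra `A` of a nonassociative algebra. -/
def IsIdealOf {F M : Type*} [Field F] [NonUnitalNonAssocRing M] [Module F M]
    (A : NonUnitalSubalgebra F M) (I : Submodule F M) : Prop :=
  I ≤ A.toSubmodule ∧ ∀ a ∈ A, ∀ u ∈ I, a * u ∈ I ∧ u * a ∈ I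

/-- `R` is the radical of the axial algebra `A` with generating set of axes `X`: the largest ideal
of `A` containing no element of `X`. -/
def IsAxialRadical {F M : Type*} [Field F] [NonUnitalNonAssocRing M] [Module F M]
    (A : NonUnitalSubalgebra F M) (X : Set M) (R : Submodule F M) : Prop :=
  IsGreatest {I : Submodule F M | IsIdealOf A I ∧ ∀ x ∈ X, x ∉ I} R

/-! ### Symplectic groups over the field with two elements -/

namespace Symplectic

variable {V : Type*} [AddCommGroup V] [Module (ZMod 2) V] (B : LinearMap.BilinForm (ZMod 2) V)

/-- The isometry group of a bilinear form over `𝔽₂`. For a nondegenerate alternating form on a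
space of dimension `2m` this is the symplectic group `Sp_{2m}(2)`. -/
def Sp : Subgroup (V ≃ₗ[ZMod 2] V) where
  carrier := {g | ∀ u v, B (g u) (g v) = B u v}
  mul_mem' {g h} hg hh u v := by
    rw [LinearEquiv.mul_apply, LinearEquiv.mul_apply, hg, hh]
  one_mem' _ _ := rfl
  inv_mem' {g} hg u v := by
    have h := hg (g⁻¹ u) (g⁻¹ v)
    have key : ∀ x, g (g⁻¹ x) = x := fun x => g.apply_symm_apply x
    rw [key, key] at h
    exact h.symm

variable {B}

theorem add_self' (x : V) : x + x = 0 := by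
  have h : (1 + 1 : ZMod 2) • x = 0 := by
    rw [show (1 + 1 : ZMod 2) = 0 from rfl, zero_smul]
  rwa [add_smul, one_smul] at h

theorem zmod_cases (a : ZMod 2) : a = 0 ∨ a = 1 := by
  revert a; decide

theorem symm_of_alt (hB : B.IsAlt) (u v : V) : B u v = B v u := by
  rw [← hB.neg_eq u v, ZMod.neg_eq_self_mod_two]

theorem transvection_involutive (hB : B.IsAlt) (v u : V) :
    (u + B u v • v) + B (u + B u v • v) v • v = u := by
  rw [map_add, LinearMap.add_apply, map_smul, LinearMap.smul_apply, hB v, smul_zero, add_zero,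
    add_assoc, add_self', add_zero]

/-- The symplectic transvection `r_v : u ↦ u + (u, v) v`. -/
def transvection (hB : B.IsAlt) (v : V) : Sp B :=
  ⟨{ toFun := fun u => u + B u v • v
     map_add' := fun x y => by
      rw [map_add, LinearMap.add_apply, add_smul]; abel
     map_smul' := fun r x => by
      rw [map_smul, LinearMap.smul_apply, smul_add, smul_assoc, RingHom.id_apply]
     invFun := fun u => u + B u v • v
     left_inv := transvection_involutive hB v
     right_inv := transvection_involutive hB v },
   fun x y => by
    change B (x + B x v • v) (y + B y v • v) = B x y
    simp only [map_add, map_smul, LinearMap.add_apply, LinearMap.smul_apply, smul_eq_mul, hB v,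
      symm_of_alt hB v y, mul_zero, add_zero]
    rw [add_assoc, mul_comm (B y v), CharTwo.add_self_eq_zero, add_zero]⟩

theorem transvection_apply (hB : B.IsAlt) (v u : V) :
    (transvection hB v : V ≃ₗ[ZMod 2] V) u = u + B u v • v := rfl

theorem Sp_ext {g h : Sp B} (H : ∀ u, (g : V ≃ₗ[ZMod 2] V) u = (h : V ≃ₗ[ZMod 2] V) u) : g = h :=
  Subtype.ext (LinearEquiv.ext H)

theorem coe_mul_apply (g h : Sp B) (u : V) :
    ((g * h : Sp B) : V ≃ₗ[ZMod 2] V) u = (g : V ≃ₗ[ZMod 2] V) ((h : V ≃ₗ[ZMod 2] V) u) := rfl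

theorem coe_one_apply (u : V) : ((1 : Sp B) : V ≃ₗ[ZMod 2] V) u = u := rfl

theorem transvection_mul_self (hB : B.IsAlt) (v : V) :
    transvection hB v * transvection hB v = 1 :=
  Sp_ext fun u => transvection_involutive hB v u

theorem conj_transvection (hB : B.IsAlt) (g : Sp B) (v : V) :
    g * transvection hB v * g⁻¹ = transvection hB ((g : V ≃ₗ[ZMod 2] V) v) := by
  rw [mul_inv_eq_iff_eq_mul]
  refine Sp_ext fun u => ?_
  simp only [coe_mul_apply, transvection_apply, map_add, map_smul]
  rw [g.2 u v]

theorem exists_form_eq_one (hnd : B.Nondegenerate) {v : V} (hv : v ≠ 0) : ∃ u, B u v = 1 := by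
  by_contra! h
  exact hv (hnd.2 v fun u => (zmod_cases (B u v)).resolve_right (h u))

theorem transvection_ne_one (hB : B.IsAlt) (hnd : B.Nondegenerate) {v : V} (hv : v ≠ 0) :
    transvection hB v ≠ 1 := by
  intro h
  obtain ⟨u, hu⟩ := exists_form_eq_one hnd hv
  have h1 := transvection_apply hB v u
  rw [h, hu, one_smul, coe_one_apply] at h1
  exact hv (by simpa using h1.symm)

theorem transvection_injective (hB : B.IsAlt) (hnd : B.Nondegenerate) {v w : V} (hv : v ≠ 0)
    (h : transvection hB v = transvection hB w) : v = w := by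
  obtain ⟨u, hu⟩ := exists_form_eq_one hnd hv
  have h1 := transvection_apply hB v u
  rw [h, transvection_apply, hu, one_smul] at h1
  rcases zmod_cases (B u w) with h2 | h2
  · rw [h2, zero_smul] at h1
    exact absurd (add_left_cancel h1).symm hv
  · rw [h2, one_smul] at h1
    exact (add_left_cancel h1).symm

theorem transvection_mul_order (hB : B.IsAlt) (v w : V) :
    orderOf (transvection hB v * transvection hB w) ∈ Set.Icc 1 3 := by
  have hr : ∀ x : V, (transvection hB x)⁻¹ = transvection hB x := fun x =>
    inv_eq_of_mul_eq_one_left (transvection_mul_self hB x)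
  have key : ∀ n : ℕ, 0 < n → n ≤ 3 → (transvection hB v * transvection hB w) ^ n = 1 →
      orderOf (transvection hB v * transvection hB w) ∈ Set.Icc 1 3 := fun n h0 h3 h =>
    ⟨orderOf_pos_iff.mpr (isOfFinOrder_iff_pow_eq_one.mpr ⟨n, h0, h⟩),
      (orderOf_le_of_pow_eq_one h0 h).trans h3⟩
  rcases zmod_cases (B w v) with h | h
  · refine key 2 two_pos (by norm_num) ?_
    have h1 := conj_transvection hB (transvection hB v) w
    rw [transvection_apply, h, zero_smul, add_zero, hr] at h1
    rw [pow_two, ← mul_assoc, h1, transvection_mul_self]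
  · refine key 3 three_pos le_rfl ?_
    have h1 := conj_transvection hB (transvection hB v) w
    have h2 := conj_transvection hB (transvection hB w) v
    rw [transvection_apply, h, one_smul, hr] at h1
    rw [transvection_apply, symm_of_alt hB v w, h, one_smul, hr, add_comm] at h2
    have h3 := h1.trans h2.symm
    calc (transvection hB v * transvection hB w) ^ 3
        = (transvection hB v * transvection hB w * transvection hB v) *
          (transvection hB w * transvection hB v * transvection hB w) := by
          simp only [pow_succ, pow_zero, one_mul, mul_assoc]
      _ = 1 := by
          rw [← h3, h1, transvection_mul_self]

/-- A nontrivial isometry becomes one with more fixed vectors after multiplication by a product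
of transvections. -/
theorem exists_more_fixed [FiniteDimensional (ZMod 2) V] (hB : B.IsAlt) (hnd : B.Nondegenerate)
    (g : Sp B) (hg : g ≠ 1) : ∃ h ∈ Subgroup.closure {g : Sp B | ∃ v, v ≠ 0 ∧ g = transvection hB v},
      LinearMap.eqLocus (g : V ≃ₗ[ZMod 2] V).toLinearMap LinearMap.id <
        LinearMap.eqLocus ((h * g : Sp B) : V ≃ₗ[ZMod 2] V).toLinearMap LinearMap.id := by
  set H := Subgroup.closure {g : Sp B | ∃ v, v ≠ 0 ∧ g = transvection hB v} with hH
  have htr : ∀ w : V, transvection hB w ∈ H := by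
    intro w
    by_cases hw : w = 0
    · have : transvection hB w = 1 := Sp_ext fun u => by
        rw [transvection_apply, hw, smul_zero, add_zero, coe_one_apply]
      rw [this]; exact one_mem _
    · exact Subgroup.subset_closure ⟨w, hw, rfl⟩
  have mem : ∀ (k : Sp B) (x : V), x ∈ LinearMap.eqLocus (k : V ≃ₗ[ZMod 2] V).toLinearMap
      LinearMap.id ↔ (k : V ≃ₗ[ZMod 2] V) x = x := fun k x => Iff.rfl
  have lt : ∀ (h : Sp B) (v : V), (g : V ≃ₗ[ZMod 2] V) v ≠ v →
      (h : V ≃ₗ[ZMod 2] V) ((g : V ≃ₗ[ZMod 2] V) v) = v →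
      (∀ x, (g : V ≃ₗ[ZMod 2] V) x = x → (h : V ≃ₗ[ZMod 2] V) x = x) →
      LinearMap.eqLocus (g : V ≃ₗ[ZMod 2] V).toLinearMap LinearMap.id <
        LinearMap.eqLocus ((h * g : Sp B) : V ≃ₗ[ZMod 2] V).toLinearMap LinearMap.id := by
    intro h v h1 h2 h3
    refine lt_of_le_of_ne (fun x hx => ?_) fun heq => ?_
    · rw [mem] at hx ⊢
      rw [coe_mul_apply, hx, h3 x hx]
    · have : v ∈ LinearMap.eqLocus ((h * g : Sp B) : V ≃ₗ[ZMod 2] V).toLinearMap LinearMap.id := h2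
      rw [← heq, mem] at this
      exact h1 this
  have fixform : ∀ v x, (g : V ≃ₗ[ZMod 2] V) x = x → B x ((g : V ≃ₗ[ZMod 2] V) v) = B x v := by
    intro v x hx
    conv_lhs => rw [← hx]
    exact g.2 x v
  by_cases hc : ∃ v, B v ((g : V ≃ₗ[ZMod 2] V) v) = 1
  · obtain ⟨v, hv⟩ := hc
    refine ⟨transvection hB ((g : V ≃ₗ[ZMod 2] V) v + v), htr _, lt _ v ?_ ?_ ?_⟩
    · intro h
      rw [h, hB v] at hv
      exact zero_ne_one hv
    · rw [transvection_apply, map_add, hB, zero_add, symm_of_alt hB, hv, one_smul, ← add_assoc,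
        add_self', zero_add]
    · intro x hx
      rw [transvection_apply, map_add, fixform v x hx, CharTwo.add_self_eq_zero, zero_smul,
        add_zero]
  · have hc' : ∀ v, B v ((g : V ≃ₗ[ZMod 2] V) v) = 0 := fun v =>
      (zmod_cases _).resolve_right fun h => hc ⟨v, h⟩
    obtain ⟨v, hv⟩ : ∃ v, (g : V ≃ₗ[ZMod 2] V) v ≠ v := by
      by_contra! h
      exact hg (Sp_ext h)
    set w := (g : V ≃ₗ[ZMod 2] V) v with hw
    set U := LinearMap.eqLocus (g : V ≃ₗ[ZMod 2] V).toLinearMap LinearMap.id with hU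
    have hvU : v ∉ U ⊔ Submodule.span (ZMod 2) {v + w} := by
      intro h
      obtain ⟨x, hx, y, hy, hxy⟩ := Submodule.mem_sup.mp h
      obtain ⟨c, rfl⟩ := Submodule.mem_span_singleton.mp hy
      rw [hU, mem] at hx
      rcases zmod_cases c with rfl | rfl
      · rw [zero_smul, add_zero] at hxy
        rw [hxy, ← hw] at hx
        exact hv hx
      · rw [one_smul] at hxy
        have hxw : x = w := by
          have h1 : (x + w) + v = 0 + v := by
            rw [zero_add, add_assoc, add_comm w v, hxy]
          have h2 := add_right_cancel h1
          rw [← add_self' w] at h2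
          exact add_right_cancel h2
        have : (g : V ≃ₗ[ZMod 2] V) w = (g : V ≃ₗ[ZMod 2] V) v := by rw [← hxw, hx, hxw]
        exact hv ((g : V ≃ₗ[ZMod 2] V).injective this)
    obtain ⟨f, hf1, hf2⟩ := Submodule.exists_dual_map_eq_bot_of_notMem hvU inferInstance
    have hf0 : ∀ x ∈ U ⊔ Submodule.span (ZMod 2) {v + w}, f x = 0 := by
      intro x hx
      have : f x ∈ Submodule.map f (U ⊔ Submodule.span (ZMod 2) {v + w}) :=
        Submodule.mem_map_of_mem hx
      rwa [hf2, Submodule.mem_bot] at this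
    have hfv : f v = 1 := (zmod_cases _).resolve_left hf1
    have hfw : f w = 1 := by
      have h := hf0 (v + w) (Submodule.mem_sup_right (Submodule.mem_span_singleton_self _))
      rw [map_add, hfv] at h
      rcases zmod_cases (f w) with h1 | h1
      · rw [h1] at h; exact absurd h (by decide)
      · exact h1
    obtain ⟨u, hu⟩ : ∃ u, ∀ x, B x u = B x v + f x := by
      refine ⟨v + (B.toDual hnd).symm f, fun x => ?_⟩
      rw [map_add, symm_of_alt hB x ((B.toDual hnd).symm f),
        LinearMap.BilinForm.apply_toDual_symm_apply]
    have huv : B v u = 1 := by rw [hu, hB v, zero_add, hfv]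
    have huw : B w u = 1 := by rw [hu, symm_of_alt hB w v, hw, hc' v, zero_add, ← hw, hfw]
    refine ⟨transvection hB (v + u) * transvection hB (u + w), mul_mem (htr _) (htr _),
      lt _ v hv ?_ ?_⟩
    · have h1 : (transvection hB (u + w) : V ≃ₗ[ZMod 2] V) w = u := by
        rw [transvection_apply, map_add, huw, hB w, add_zero, one_smul, add_left_comm, add_self',
          add_zero]
      rw [← hw, coe_mul_apply, h1, transvection_apply, map_add, hB u, add_zero,
        symm_of_alt hB u v, huv, one_smul, add_left_comm, add_self', add_zero]
    · intro x hx
      have hxu : B x u = B x v := by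
        rw [hu, hf0 x (Submodule.mem_sup_left hx), add_zero]
      have h1 : (transvection hB (u + w) : V ≃ₗ[ZMod 2] V) x = x := by
        rw [transvection_apply, map_add, hxu, hw, fixform v x hx, CharTwo.add_self_eq_zero,
          zero_smul, add_zero]
      rw [coe_mul_apply, h1, transvection_apply, map_add, hxu, CharTwo.add_self_eq_zero, zero_smul,
        add_zero]

theorem closure_transvections [FiniteDimensional (ZMod 2) V] (hB : B.IsAlt)
    (hnd : B.Nondegenerate) :
    Subgroup.closure {g : Sp B | ∃ v, v ≠ 0 ∧ g = transvection hB v} = ⊤ := by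
  rw [eq_top_iff]
  rintro g -
  induction hU : LinearMap.eqLocus (g : V ≃ₗ[ZMod 2] V).toLinearMap LinearMap.id using
    WellFoundedGT.induction generalizing g with
  | ind U ih =>
    by_cases hg : g = 1
    · rw [hg]; exact one_mem _
    · obtain ⟨h, hh, hlt⟩ := exists_more_fixed hB hnd g hg
      rw [hU] at hlt
      exact (Subgroup.mul_mem_cancel_left _ hh).mp (ih _ hlt rfl)

/-- `Sp_{2m}(2)` with its class of symplectic transvections, as a 3-transposition group. -/
def threeTranspositionGroup [FiniteDimensional (ZMod 2) V] (hB : B.IsAlt)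
    (hnd : B.Nondegenerate) : ThreeTranspositionGroup (Sp B) where
  D := {g | ∃ v, v ≠ 0 ∧ g = transvection hB v}
  conj_mem := by
    rintro g _ ⟨v, hv, rfl⟩
    refine ⟨((g⁻¹ : Sp B) : V ≃ₗ[ZMod 2] V) v, ?_, ?_⟩
    · exact fun h => hv ((LinearEquiv.map_eq_zero_iff _).mp h)
    · have h := conj_transvection hB g⁻¹ v
      rwa [inv_inv] at h
  closure_eq_top := closure_transvections hB hnd
  orderOf_eq_two := by
    rintro _ ⟨v, hv, rfl⟩
    exact orderOf_eq_prime (by rw [pow_two, transvection_mul_self]) (transvection_ne_one hB hnd hv)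
  orderOf_mul_mem := by
    rintro _ ⟨v, -, rfl⟩ _ ⟨w, -, rfl⟩
    exact transvection_mul_order hB v w

/-- The product `r_{e₁} r_{e₂} ⋯ r_{eₘ}` of the transvections in the given vectors. -/
def tau (hB : B.IsAlt) {m : ℕ} (e : Fin m → V) : Sp B :=
  (List.ofFn fun i => transvection hB (e i)).prod

theorem tau_apply (hB : B.IsAlt) {m : ℕ} (e : Fin m → V) (he : ∀ i j, B (e i) (e j) = 0) (u : V) :
    (tau hB e : V ≃ₗ[ZMod 2] V) u = u + ∑ i, B u (e i) • e i := by
  induction m with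
  | zero => simp [tau]
  | succ m ih =>
    have h : tau hB e = transvection hB (e 0) * tau hB (fun i => e i.succ) := by
      simp [tau, List.ofFn_succ]
    rw [h, coe_mul_apply, ih _ (fun i j => he _ _), transvection_apply, Fin.sum_univ_succ]
    simp only [map_add, map_sum, map_smul, LinearMap.add_apply, LinearMap.sum_apply,
      LinearMap.smul_apply, he, smul_zero, Finset.sum_const_zero, add_zero]
    abel

theorem tau_mul_self (hB : B.IsAlt) {m : ℕ} (e : Fin m → V) (he : ∀ i j, B (e i) (e j) = 0) :
    tau hB e * tau hB e = 1 := by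
  refine Sp_ext fun u => ?_
  rw [coe_mul_apply, coe_one_apply, tau_apply hB e he u, tau_apply hB e he]
  simp only [map_add, map_sum, map_smul, LinearMap.add_apply, LinearMap.sum_apply,
    LinearMap.smul_apply, he, smul_zero, Finset.sum_const_zero, add_zero]
  rw [add_assoc, add_self', add_zero]

theorem tau_ne_one (hB : B.IsAlt) (hnd : B.Nondegenerate) {m : ℕ} (hm : 0 < m) (e : Fin m → V)
    (he : ∀ i j, B (e i) (e j) = 0) (hli : LinearIndependent (ZMod 2) e) : tau hB e ≠ 1 := by
  intro h
  obtain ⟨u, hu⟩ := exists_form_eq_one hnd (hli.ne_zero ⟨0, hm⟩)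
  have h1 := tau_apply hB e he u
  rw [h, coe_one_apply] at h1
  have h2 : ∑ i, B u (e i) • e i = 0 := by simpa using h1.symm
  have h3 := Fintype.linearIndependent_iff.mp hli _ h2 ⟨0, hm⟩
  rw [hu] at h3
  exact one_ne_zero h3

/-- The flip of `(Sp_{2m}(2), D)` induced by (i.e. conjugation with)
`τ_m = r_{e₁} r_{e₂} ⋯ r_{eₘ}`, where `e₁, …, eₘ` are linearly independent and span a totally
isotropic subspace. -/
def tauFlip [FiniteDimensional (ZMod 2) V] (hB : B.IsAlt) (hnd : B.Nondegenerate) {m : ℕ}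
    (hm : 0 < m) (e : Fin m → V) (he : ∀ i j, B (e i) (e j) = 0)
    (hli : LinearIndependent (ZMod 2) e) : (threeTranspositionGroup hB hnd).Flip where
  toMulAut := MulAut.conj (tau hB e)
  image_eq := by
    have hsub : ∀ g : Sp B, ∀ d ∈ (threeTranspositionGroup hB hnd).D,
        g * d * g⁻¹ ∈ (threeTranspositionGroup hB hnd).D := fun g d hd => by
      have h := (threeTranspositionGroup hB hnd).conj_mem g⁻¹ d hd
      rwa [inv_inv] at h
    refine Set.Subset.antisymm ?_ fun d hd => ?_
    · rintro _ ⟨d, hd, rfl⟩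
      exact hsub _ d hd
    · refine ⟨_, (threeTranspositionGroup hB hnd).conj_mem (tau hB e) d hd, ?_⟩
      rw [MulAut.conj_apply]
      group
  orderOf_eq_two := by
    refine orderOf_eq_prime ?_ fun h => tau_ne_one hB hnd hm e he hli (Sp_ext fun v => ?_)
    · rw [← map_pow, pow_two, tau_mul_self hB e he, map_one]
    · rw [coe_one_apply]
      by_cases hv : v = 0
      · rw [hv, map_zero]
      · refine (transvection_injective hB hnd hv ?_).symm
        rw [← conj_transvection, ← MulAut.conj_apply, h, MulAut.one_apply]

/-- The rank of (the flip induced by) an isometry `t`: the dimension of the commutator space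
`[V, t]`. -/
noncomputable def flipRank (t : Sp B) : ℕ :=
  finrank (ZMod 2) (LinearMap.range ((t : V ≃ₗ[ZMod 2] V).toLinearMap - LinearMap.id))

/-- (The flip induced by) an isometry `t` is of type `1` if `{v | (v, t v) = 0}` is a hyperplane
of `V`. -/
def IsTypeOne (t : Sp B) : Prop :=
  ∃ H : Submodule (ZMod 2) V, IsCoatom H ∧
    ∀ v, v ∈ H ↔ B v ((t : V ≃ₗ[ZMod 2] V) v) = 0

end Symplectic

/-! Put `z = ∑ i, e i`. Since `(τ v, v) = (v, z)`, the axes `v` and `τ v` are equal or multiply to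
`0` exactly when `v` lies in the hyperplane `z⊥`. Hence `A` consists of all `τ`-invariant elements
supported on `z⊥` (`flipSubalgebra_eq`). In coordinates, an element of the radical is a
`τ`-invariant function `f` on `z⊥` with `f 0 = 0` and `f + (η/2) S f = 0` on `z⊥`, where `S` sums
over the `w` with `(v, w) = 1` (`map_coords_radical`).

Writing the indicator of `(v, w) = 1` as `(1 - (-1)^(v, w)) / 2` turns this equation into `f = (η/4)
(Φ f - ∑ f)` on `z⊥`, with `Φ` the Fourier operator of `z⊥`. As `Φ f` is invariant under translation
by `z`, so is `f`, and on such functions `Φ² = |V| = 2^(2m)` (`fourier_fourier`). Summing over `v`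
gives `(∑ f) (8 + η |V|) = 0`.

If `∑ f ≠ 0`, then `η = -8 / |V|`, and the solutions are the multiples of the indicator of `z⊥`
minus `0` and `z`. If `∑ f = 0` and `f ≠ 0`, then `Φ f = (4/η) f`, so `c = 4/η` satisfies `c² =
|V|`, that is, `c = ±2^m`. In that case the radical is the hyperplane `f 0 = 0` in the
`c`-eigenspace of `Φ` on invariant functions. The dimension of that eigenspace is the trace of an
explicit projection (`isProj_eigenProj`, `trace_eigenProj`), computed by counting the `v` in `z⊥`
with `τ v = v` or `τ v = v + z`. The latter exist only for even `m`, which is why the parity of `m`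
matters.

The form radical is the axial radical because suitable polynomials in the multiplication by a single
or a double send any `u` in `A` to a multiple of that axis; the coefficient is, up to a nonzero
factor, the value of the form (`isAxialRadical_radical`). -/

set_option linter.unusedSectionVars false

/-! ### Fourier analysis on the hyperplane `z⊥` -/

namespace SymplecticFunctions

variable {F : Type*} [Field F] {V : Type*} [AddCommGroup V] [Module (ZMod 2) V]
  {B : LinearMap.BilinForm (ZMod 2) V}

/-- The sign of an element of `𝔽₂`. -/
def sgn (F : Type*) [Field F] (a : ZMod 2) : F := if a = 0 then 1 else -1

@[simp] theorem sgn_zero : sgn F 0 = 1 := if_pos rfl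

@[simp] theorem sgn_one : sgn F 1 = -1 := if_neg one_ne_zero

theorem sgn_add (a b : ZMod 2) : sgn F (a + b) = sgn F a * sgn F b := by
  rcases Symplectic.zmod_cases a with rfl | rfl <;> rcases Symplectic.zmod_cases b with rfl | rfl
  · simp
  · simp
  · simp
  · rw [show (1 + 1 : ZMod 2) = 0 from rfl]; simp

theorem add_eq_zero_iff (u v : V) : u + v = 0 ↔ u = v := by
  refine ⟨fun h => ?_, fun h => h ▸ Symplectic.add_self' u⟩
  rw [← Symplectic.add_self' v] at h
  exact add_right_cancel h

theorem add_add_cancel (u v : V) : u + v + v = u := by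
  rw [add_assoc, Symplectic.add_self', add_zero]

section Fourier

variable [Fintype V] [DecidableEq V] [CharZero F]

/-- Orthogonality of characters: translating by some `w₀` with `(u, w₀) = 1` changes the sign of the
sum. -/
theorem sum_sgn (hnd : B.Nondegenerate) (hB : B.IsAlt) (u : V) :
    ∑ w, sgn F (B u w) = if u = 0 then (Fintype.card V : F) else 0 := by
  split_ifs with hu
  · simp [hu]
  · obtain ⟨w₀, hw₀⟩ := Symplectic.exists_form_eq_one hnd hu
    have h := Equiv.sum_comp (Equiv.addRight w₀) fun w => sgn F (B u w)
    simp only [Equiv.coe_addRight, map_add, sgn_add, Symplectic.symm_of_alt hB u w₀, hw₀, sgn_one,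
      mul_neg, mul_one, Finset.sum_neg_distrib] at h
    exact self_eq_neg.mp h.symm

/-- The indicator function of the hyperplane `z⊥`. -/
def ind (F : Type*) [Field F] (B : LinearMap.BilinForm (ZMod 2) V) (z v : V) : F :=
  if B v z = 0 then 1 else 0

theorem ind_eq (z v : V) : ind F B z v = (1 + sgn F (B v z)) / 2 := by
  unfold ind sgn
  split_ifs <;> norm_num

/-- The operator on functions with kernel `(-1)^(v, w)` on the hyperplane `z⊥`. -/
def fourier (B : LinearMap.BilinForm (ZMod 2) V) (z : V) : (V → F) →ₗ[F] (V → F) where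
  toFun f v := ind F B z v * ∑ w, ind F B z w * sgn F (B v w) * f w
  map_add' f g := by
    ext v; simp only [Pi.add_apply, mul_add, Finset.sum_add_distrib]
  map_smul' c f := by
    ext v
    simp only [Pi.smul_apply, smul_eq_mul, RingHom.id_apply, Finset.mul_sum]
    exact Finset.sum_congr rfl fun w _ => by ring

theorem fourier_apply (z v : V) (f : V → F) :
    fourier B z f v = ind F B z v * ∑ w, ind F B z w * sgn F (B v w) * f w := rfl

theorem ind_add (hB : B.IsAlt) (z v : V) : ind F B z (v + z) = ind F B z v := by
  unfold ind; rw [map_add, LinearMap.add_apply, hB z, add_zero]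

theorem ind_mul_self (z v : V) : ind F B z v * ind F B z v = ind F B z v := by
  unfold ind; split_ifs <;> simp

theorem ind_mul_sgn_add (hB : B.IsAlt) (z v w : V) :
    ind F B z w * sgn F (B (v + z) w) = ind F B z w * sgn F (B v w) := by
  unfold ind
  split_ifs with h
  · rw [map_add, LinearMap.add_apply, Symplectic.symm_of_alt hB z, h, add_zero]
  · simp

theorem fourier_add (hB : B.IsAlt) (z v : V) (f : V → F) :
    fourier B z f (v + z) = fourier B z f v := by
  simp only [fourier_apply, ind_add hB, ind_mul_sgn_add hB]

/-- The characters trivial on `z⊥` are those of `0` and `z`. This is what makes the square of the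
Fourier operator a projection onto `z`-invariant functions, up to scale. -/
theorem sum_ind_mul_sgn (hnd : B.Nondegenerate) (hB : B.IsAlt) (z u : V) :
    ∑ w, ind F B z w * sgn F (B u w) =
      (Fintype.card V : F) / 2 * ((if u = 0 then 1 else 0) + if u = z then 1 else 0) := by
  have h : ∀ w, ind F B z w * sgn F (B u w) = (sgn F (B u w) + sgn F (B (u + z) w)) / 2 := by
    intro w
    rw [ind_eq, map_add, LinearMap.add_apply, sgn_add, Symplectic.symm_of_alt hB w z]
    ring
  simp only [h, ← Finset.sum_div, Finset.sum_add_distrib, sum_sgn hnd hB, add_eq_zero_iff]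
  split_ifs <;> ring

theorem fourier_fourier (hnd : B.Nondegenerate) (hB : B.IsAlt) (z v : V) (f : V → F) :
    fourier B z (fourier B z f) v =
      (Fintype.card V : F) / 2 * (ind F B z v * (f v + f (v + z))) := by
  have h : ∀ w, ind F B z w * sgn F (B v w) * (ind F B z w * ∑ u, ind F B z u * sgn F (B w u) * f u)
      = ∑ u, (ind F B z u * f u) * (ind F B z w * sgn F (B (v + u) w)) := by
    intro w
    rw [Finset.mul_sum, Finset.mul_sum]
    refine Finset.sum_congr rfl fun u _ => ?_
    rw [map_add, LinearMap.add_apply, sgn_add, Symplectic.symm_of_alt hB u w]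
    linear_combination (sgn F (B v w) * ind F B z u * sgn F (B w u) * f u) *
      ind_mul_self (F := F) (B := B) z w
  rw [fourier_apply]
  simp only [fourier_apply, h]
  rw [Finset.sum_comm]
  simp only [← Finset.mul_sum, sum_ind_mul_sgn hnd hB]
  have e1 : ∀ u, (v + u = 0 ↔ u = v) := fun u => by rw [add_eq_zero_iff, eq_comm]
  have e2 : ∀ u, (v + u = z ↔ u = v + z) := fun u => by
    constructor
    · rintro rfl; rw [← add_assoc, Symplectic.add_self', zero_add]
    · rintro rfl; rw [← add_assoc, Symplectic.add_self', zero_add]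
  simp only [e1, e2, mul_add, mul_ite, mul_one, mul_zero, Finset.sum_add_distrib,
    Finset.sum_ite_eq', Finset.mem_univ, if_true, ind_add hB]
  linear_combination ((f v + f (v + z)) * (Fintype.card V : F) / 2) *
    ind_mul_self (F := F) (B := B) z v

end Fourier

/-! ### Eigenspaces of the Fourier operator on invariant functions -/

section Invariant

variable [Fintype V] [DecidableEq V] [CharZero F]

theorem ind_isometry {τ : V → V} (hτB : ∀ u v, B (τ u) (τ v) = B u v) {z : V} (hτz : τ z = z)
    (v : V) : ind F B z (τ v) = ind F B z v := by
  unfold ind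
  rw [show B (τ v) z = B v z by rw [← hτB v z, hτz]]

theorem fourier_comp {τ : V → V} (hτB : ∀ u v, B (τ u) (τ v) = B u v)
    (hττ : Function.Involutive τ) {z : V} (hτz : τ z = z) (f : V → F) :
    fourier B z (f ∘ τ) = fourier B z f ∘ τ := by
  ext v
  rw [Function.comp_apply, fourier_apply, fourier_apply, ind_isometry hτB hτz]
  congr 1
  rw [← Equiv.sum_comp (hττ.toPerm τ)]
  refine Finset.sum_congr rfl fun w _ => ?_
  rw [Function.Involutive.coe_toPerm, Function.comp_apply, hττ w, ind_isometry hτB hτz,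
    ← hτB v (τ w), hττ w]

/-- For `v` in `z⊥` the character `(-1)^(v, w)` is unchanged when `w` is replaced by `w + z`. -/
theorem fourier_comp_add (hB : B.IsAlt) (z : V) (f : V → F) :
    fourier B z (fun v => f (v + z)) = fourier B z f := by
  ext v
  rw [fourier_apply, fourier_apply]
  by_cases hv : B v z = 0
  · congr 1
    rw [← Equiv.sum_comp (Equiv.addRight z)]
    refine Finset.sum_congr rfl fun w _ => ?_
    simp only [Equiv.coe_addRight]
    rw [add_add_cancel, ind_add hB, map_add, hv, add_zero]
  · simp [ind, hv]

theorem fourier_ind_mul (z : V) (f : V → F) :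
    fourier B z (fun v => ind F B z v * f v) = fourier B z f := by
  ext v
  rw [fourier_apply, fourier_apply]
  congr 1
  refine Finset.sum_congr rfl fun w _ => ?_
  linear_combination (sgn F (B v w) * f w) *
      ind_mul_self (F := F) (B := B) z w

/-- The functions supported on `z⊥` that are invariant under `τ` and translation by `z` and
are eigenvectors of the Fourier operator with eigenvalue `c`. -/
def eigenFunctions (B : LinearMap.BilinForm (ZMod 2) V) (z : V) (τ : V → V) (c : F) :
    Submodule F (V → F) where
  carrier := {f | (∀ v, ind F B z v * f v = f v) ∧ (∀ v, f (v + z) = f v) ∧ (∀ v, f (τ v) = f v) ∧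
    fourier B z f = c • f}
  zero_mem' := by simp
  add_mem' := by
    rintro f g ⟨hf1, hf2, hf3, hf4⟩ ⟨hg1, hg2, hg3, hg4⟩
    exact ⟨fun v => by simp [mul_add, hf1, hg1], fun v => by simp [hf2, hg2],
      fun v => by simp [hf3, hg3], by rw [map_add, hf4, hg4, smul_add]⟩
  smul_mem' := by
    rintro a f ⟨hf1, hf2, hf3, hf4⟩
    refine ⟨fun v => ?_, fun v => by simp [hf2],
      fun v => by simp [hf3], by rw [map_smul, hf4, smul_comm]⟩
    rw [Pi.smul_apply, smul_eq_mul, mul_left_comm, hf1]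

/-- The projection onto `eigenFunctions B z τ c`, where `c ^ 2 = card V`. -/
def eigenProj (B : LinearMap.BilinForm (ZMod 2) V) (z : V) (τ : V → V) (c : F) :
    (V → F) →ₗ[F] (V → F) where
  toFun f v := ind F B z v * (f v + f (v + z) + f (τ v) + f (τ v + z)) / 8 +
    (fourier B z f v + fourier B z f (τ v)) / (4 * c)
  map_add' f g := by
    ext v; simp only [Pi.add_apply, map_add]; ring
  map_smul' a f := by
    ext v; simp only [Pi.smul_apply, map_smul, smul_eq_mul, RingHom.id_apply]; ring

theorem eigenProj_apply (z : V) (τ : V → V) (c : F) (f : V → F) (v : V) :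
    eigenProj B z τ c f v = ind F B z v * (f v + f (v + z) + f (τ v) + f (τ v + z)) / 8 +
    (fourier B z f v + fourier B z f (τ v)) / (4 * c) := rfl

/-- With `T` the translation by `z`, the map is the restriction to `z⊥` followed by the average `(1
+ T)(1 + τ) / 4` and by `(1 + Φ / c) / 2`. The last factor projects onto the `c`-eigenspace because
`Φ² = c²` on `T`-invariant functions. Since `Φ T = Φ`, the four Fourier terms collapse to two,
whence the denominators `8` and `4 * c`. -/
theorem isProj_eigenProj (hnd : B.Nondegenerate) (hB : B.IsAlt) {z : V} {τ : V →ₗ[ZMod 2] V}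
    (hτB : ∀ u v, B (τ u) (τ v) = B u v) (hττ : Function.Involutive τ) (hτz : τ z = z) {c : F}
    (hc : c ^ 2 = Fintype.card V) :
    LinearMap.IsProj (eigenFunctions B z τ c) (eigenProj B z τ c) := by
  have hc0 : c ≠ 0 := by
    rintro rfl
    have : (Fintype.card V : F) ≠ 0 := Nat.cast_ne_zero.mpr Fintype.card_ne_zero
    exact this (by rw [← hc]; simp)
  refine ⟨fun f => ⟨fun v => ?_, fun v => ?_, fun v => ?_, ?_⟩, ?_⟩
  · simp only [eigenProj_apply, fourier_apply, ind_isometry hτB hτz]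
    linear_combination ((f v + f (v + z) + f (τ v) + f (τ v + z)) / 8 +
      (∑ w, ind F B z w * sgn F (B v w) * f w +
        ∑ w, ind F B z w * sgn F (B (τ v) w) * f w) / (4 * c)) * ind_mul_self (F := F) (B := B) z v
  · simp only [eigenProj_apply, map_add, hτz, add_add_cancel, fourier_add hB, ind_add hB]
    ring
  · simp only [eigenProj_apply, hττ v, ind_isometry hτB hτz]
    ring
  · have key : eigenProj B z τ c f = (8⁻¹ : F) • (fun v => ind F B z v * (f v + f (v + z) +
        f (τ v) + f (τ v + z))) + (4 * c)⁻¹ • (fourier B z f + fourier B z f ∘ τ) := by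
      ext v
      simp only [eigenProj_apply, Pi.add_apply, Pi.smul_apply, smul_eq_mul, Function.comp_apply]
      ring
    have key2 : (fun v => f v + f (v + z) + f (τ v) + f (τ v + z)) =
        f + (fun v => f (v + z)) + f ∘ τ + (fun v => (f ∘ τ) (v + z)) := by
      ext v
      simp [hτz]
    have h1 : fourier B z (fun v => f v + f (v + z) + f (τ v) + f (τ v + z)) =
        (2 : F) • (fourier B z f + fourier B z f ∘ τ) := by
      rw [key2]
      simp only [map_add, fourier_comp_add hB, fourier_comp hτB hττ hτz]
      rw [two_smul]; abel
    rw [key, map_add, map_smul, map_smul, fourier_ind_mul, h1, map_add,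
      fourier_comp hτB hττ hτz]
    ext v
    simp only [Pi.add_apply, Pi.smul_apply, smul_eq_mul, Function.comp_apply,
      fourier_fourier hnd hB, ind_isometry hτB hτz, ← hc]
    field_simp
    ring
  · rintro f ⟨h1, h2, h3, h4⟩
    ext v
    simp only [eigenProj_apply, h2, h3, h4, Pi.smul_apply, smul_eq_mul]
    field_simp
    linear_combination 16 * h1 v

theorem fourier_single (z v w : V) : fourier B z (Pi.single w 1 : V → F) v =
    ind F B z v * (ind F B z w * sgn F (B v w)) := by
  simp [fourier_apply, Pi.single_apply]

/-- The permutation terms contribute their fixed points in `z⊥`; translation by `z` has none. Both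
Fourier terms have diagonal entries `1` on `z⊥`, because `(v, v) = 0` and `(τ v, v) = (v, z) = 0`
there. -/
theorem trace_eigenProj (hB : B.IsAlt) {z : V} (hz : z ≠ 0) {τ : V →ₗ[ZMod 2] V}
    (hτB : ∀ u v, B (τ u) (τ v) = B u v) (hτz : τ z = z)
    (hτH : ∀ v, B (τ v) v = B v z) {c : F} :
    LinearMap.trace F _ (eigenProj B z τ c) =
      ((Finset.univ.filter fun v => B v z = 0).card +
      (Finset.univ.filter fun v => B v z = 0 ∧ τ v = v).card +
      (Finset.univ.filter fun v => B v z = 0 ∧ τ v = v + z).card) / 8 +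
      (Finset.univ.filter fun v => B v z = 0).card / (2 * c) := by
  rw [LinearMap.trace_eq_matrix_trace F (Pi.basisFun F V), Matrix.trace]
  have e : ∀ v, τ v + z = v ↔ τ v = v + z := fun v => by
    constructor <;> intro h
    · rw [← h, add_add_cancel, h]
    · rw [h, add_add_cancel]
  have h : ∀ v, Matrix.diag (LinearMap.toMatrix (Pi.basisFun F V) (Pi.basisFun F V)
      (eigenProj B z τ c)) v = ((if B v z = 0 then 1 else 0) +
      (if B v z = 0 ∧ τ v = v then 1 else 0) + (if B v z = 0 ∧ τ v = v + z then 1 else 0)) / 8 +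
      (if B v z = 0 then 1 else 0) / (2 * c) := by
    intro v
    rw [Matrix.diag_apply, LinearMap.toMatrix_apply, Pi.basisFun_repr, Pi.basisFun_apply,
      eigenProj_apply]
    simp only [fourier_single, ind_isometry hτB hτz, Pi.single_apply, e, hτH, hB v, if_true,
      add_eq_left, hz, if_false]
    unfold ind
    by_cases hv : B v z = 0
    · simp only [hv, if_true, sgn_zero, true_and]
      have : (1 * (1 * 1) + 1 * (1 * 1)) / (4 * c) = 1 / (2 * c) := by
        rw [show (4 : F) * c = 2 * (2 * c) by ring, ← div_div]; norm_num
      rw [this]; ring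
    · simp [hv]
  simp only [h, Finset.sum_add_distrib, ← Finset.sum_div, Finset.sum_boole]

end Invariant

end SymplecticFunctions

/-! ### Solving the radical equation on functions -/

namespace SymplecticFunctions

variable {F : Type*} [Field F] {V : Type*} [AddCommGroup V] [Module (ZMod 2) V]
  {B : LinearMap.BilinForm (ZMod 2) V}

section Radical

variable [Fintype V] [DecidableEq V] [CharZero F]

/-- The functions on `z⊥` vanishing at `0` and invariant under `τ` that are in the kernel of
`1 + (η / 2) S`, where `S` is the adjacency operator of the relation `(v, w) = 1`. -/
def radFunctions (B : LinearMap.BilinForm (ZMod 2) V) (z : V) (τ : V → V) (η : F) :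
    Submodule F (V → F) where
  carrier := {f | f 0 = 0 ∧ (∀ v, ind F B z v * f v = f v) ∧ (∀ v, f (τ v) = f v) ∧
    ∀ v, B v z = 0 → f v + η / 2 * ∑ w, (1 - sgn F (B v w)) / 2 * f w = 0}
  zero_mem' := by simp
  add_mem' := by
    rintro f g ⟨hf1, hf2, hf3, hf4⟩ ⟨hg1, hg2, hg3, hg4⟩
    refine ⟨by simp [hf1, hg1], fun v => by simp [mul_add, hf2, hg2],
      fun v => by simp [hf3, hg3], fun v hv => ?_⟩
    simp only [Pi.add_apply, mul_add, Finset.sum_add_distrib]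
    linear_combination hf4 v hv + hg4 v hv
  smul_mem' := by
    rintro a f ⟨hf1, hf2, hf3, hf4⟩
    refine ⟨by simp [hf1], fun v => ?_, fun v => by simp [hf3], fun v hv => ?_⟩
    · rw [Pi.smul_apply, smul_eq_mul, mul_left_comm, hf2]
    · simp only [Pi.smul_apply, smul_eq_mul, mul_left_comm _ a, ← Finset.mul_sum]
      linear_combination a * hf4 v hv

theorem fourier_apply_of_support {z v : V} (hv : B v z = 0) {f : V → F}
    (hf : ∀ v, ind F B z v * f v = f v) :
    fourier B z f v = ∑ w, sgn F (B v w) * f w := by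
  rw [fourier_apply, ind, if_pos hv, one_mul]
  exact Finset.sum_congr rfl fun w _ => by linear_combination sgn F (B v w) * hf w

theorem sum_adjacency {z v : V} (hv : B v z = 0) {f : V → F}
    (hf : ∀ v, ind F B z v * f v = f v) :
    ∑ w, (1 - sgn F (B v w)) / 2 * f w = (∑ w, f w - fourier B z f v) / 2 := by
  rw [fourier_apply_of_support hv hf, ← Finset.sum_sub_distrib, Finset.sum_div]
  exact Finset.sum_congr rfl fun w _ => by ring

variable {z : V} {τ : V →ₗ[ZMod 2] V} {η : F} {f : V → F}

theorem radFunctions_apply (hf : f ∈ radFunctions B z τ η) {v : V} (hv : B v z = 0) :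
    f v = η / 4 * (fourier B z f v - ∑ w, f w) := by
  have h := hf.2.2.2 v hv
  rw [sum_adjacency hv hf.2.1] at h
  linear_combination h

theorem eq_zero_of_support (hf : ∀ v, ind F B z v * f v = f v) {v : V} (hv : B v z ≠ 0) :
    f v = 0 := by
  rw [← hf v, ind, if_neg hv, zero_mul]

/-- The radical equation expresses `f` on `z⊥` through its Fourier transform and a constant, and
both are invariant under translation by `z`. -/
theorem radFunctions_add (hB : B.IsAlt) (hf : f ∈ radFunctions B z τ η) (v : V) :
    f (v + z) = f v := by
  have h : B (v + z) z = B v z := by rw [map_add, LinearMap.add_apply, hB z, add_zero]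
  by_cases hv : B v z = 0
  · rw [radFunctions_apply hf hv, radFunctions_apply hf (h.trans hv), fourier_add hB]
  · rw [eq_zero_of_support hf.2.1 hv, eq_zero_of_support hf.2.1 (h ▸ hv)]

theorem radFunctions_eq (hf : f ∈ radFunctions B z τ η) :
    f = (η / 4) • (fourier B z f - (∑ w, f w) • ind F B z) := by
  ext v
  simp only [Pi.smul_apply, Pi.sub_apply, smul_eq_mul]
  by_cases hv : B v z = 0
  · rw [radFunctions_apply hf hv]
    simp [ind, hv]
  · rw [eq_zero_of_support hf.2.1 hv, fourier_apply]
    simp [ind, hv]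

theorem sum_ind (hnd : B.Nondegenerate) (hB : B.IsAlt) (hz : z ≠ 0) :
    ∑ w, ind F B z w = (Fintype.card V : F) / 2 := by
  have h := sum_ind_mul_sgn (F := F) hnd hB z 0
  simpa [hz.symm] using h

theorem fourier_zero (hf : ∀ v, ind F B z v * f v = f v) :
    fourier B z f 0 = ∑ w, f w := by
  rw [fourier_apply_of_support (by simp) hf]
  simp

theorem ind_mul_fourier (v : V) : ind F B z v * fourier B z f v = fourier B z f v := by
  rw [fourier_apply, ← mul_assoc, ind_mul_self]

/-- Sum `f = (η/4) (Φ f - (∑ f) 1_{z⊥})` over all `v`. The total of `Φ f` is `Φ (Φ f) 0 = |V| f 0`,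
which vanishes. -/
theorem radFunctions_sum (hnd : B.Nondegenerate) (hB : B.IsAlt) (hz : z ≠ 0)
    (hf : f ∈ radFunctions B z τ η) :
    (∑ w, f w) * (8 + η * Fintype.card V) = 0 := by
  have h := congrArg (fun g : V → F => ∑ w, g w) (radFunctions_eq hf)
  simp only [Pi.smul_apply, Pi.sub_apply, smul_eq_mul, ← Finset.mul_sum, Finset.sum_sub_distrib,
    sum_ind hnd hB hz] at h
  rw [← fourier_zero (B := B) (z := z) (f := fourier B z f) ind_mul_fourier,
    fourier_fourier hnd hB, radFunctions_add hB hf, hf.1] at h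
  linear_combination 8 * h

theorem radFunctions_eigen (hη : η ≠ 0) (hf : f ∈ radFunctions B z τ η) (hs : ∑ w, f w = 0) :
    fourier B z f = (4 / η) • f := by
  have h := radFunctions_eq hf
  rw [hs, zero_smul, sub_zero] at h
  nth_rewrite 2 [h]
  rw [smul_smul, show 4 / η * (η / 4) = 1 by field_simp, one_smul]

/-- A nonzero eigenfunction for `4/η` forces `(4/η)² = |V|`, because `Φ²` acts on `z`-invariant
functions on `z⊥` as `|V|`. -/
theorem sq_mul_card_eq (hnd : B.Nondegenerate) (hB : B.IsAlt) (hη : η ≠ 0)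
    (hf : f ∈ radFunctions B z τ η) (hs : ∑ w, f w = 0) (hf0 : f ≠ 0) :
    η ^ 2 * Fintype.card V = 16 := by
  obtain ⟨v, hv⟩ := Function.ne_iff.mp hf0
  have h := fourier_fourier hnd hB z v f
  rw [radFunctions_eigen hη hf hs, map_smul, radFunctions_eigen hη hf hs, radFunctions_add hB hf,
    mul_add, hf.2.1] at h
  simp only [Pi.smul_apply, smul_eq_mul] at h
  field_simp at h
  have h2 : f v * (η ^ 2 * Fintype.card V - 16) = 0 := by linear_combination -h / 2
  exact sub_eq_zero.mp ((mul_eq_zero.mp h2).resolve_left hv)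

theorem critical_of_radFunctions_ne_bot (hnd : B.Nondegenerate) (hB : B.IsAlt) (hz : z ≠ 0)
    (hη : η ≠ 0) (h : radFunctions B z τ η ≠ ⊥) :
    η * Fintype.card V = -8 ∨ η ^ 2 * Fintype.card V = 16 := by
  obtain ⟨f, hf, hf0⟩ := Submodule.exists_mem_ne_zero_of_ne_bot h
  rcases mul_eq_zero.mp (radFunctions_sum hnd hB hz hf) with hs | hs
  · exact Or.inr (sq_mul_card_eq hnd hB hη hf hs hf0)
  · exact Or.inl (by linear_combination hs)

theorem finrank_radFunctions_eq_one (hnd : B.Nondegenerate) (hB : B.IsAlt) (hz : z ≠ 0)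
    (hτB : ∀ u v, B (τ u) (τ v) = B u v) (hττ : Function.Involutive τ) (hτz : τ z = z)
    (hη : η * Fintype.card V = -8) (hV : Fintype.card V ≠ 4) :
    finrank F (radFunctions B z τ η) = 1 := by
  have hN : (Fintype.card V : F) ≠ 0 := Nat.cast_ne_zero.mpr Fintype.card_ne_zero
  have hN4 : (Fintype.card V : F) ≠ 4 := by exact_mod_cast hV
  have hη0 : η ≠ 0 := by
    rintro rfl
    norm_num at hη
  -- On `z⊥` this `g` is an eigenfunction of the adjacency operator with eigenvalue `|V| / 4`, so it
  -- solves the radical equation precisely when `1 + η |V| / 8 = 0`.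
  let g : V → F := fun v => ind F B z v - ((if v = 0 then 1 else 0) + if v = z then 1 else 0)
  have hgsum : ∑ w, g w = Fintype.card V / 2 - 2 := by
    simp only [g, Finset.sum_sub_distrib, sum_ind hnd hB hz, Finset.sum_add_distrib,
      Finset.sum_ite_eq', Finset.mem_univ, if_true]
    norm_num
  have hgsupp : ∀ v, ind F B z v * g v = g v := by
    intro v
    simp only [g, ind]
    by_cases h : B v z = 0
    · simp [h]
    · have h0 : v ≠ 0 := by rintro rfl; simp at h
      have h1 : v ≠ z := by rintro rfl; exact h (hB v)
      simp [h, h0, h1]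
  have hg : g ∈ radFunctions B z τ η := by
    refine ⟨by simp [g, ind, hz.symm], hgsupp, fun v => ?_, fun v hv => ?_⟩
    · have h1 : τ v = z ↔ v = z := ⟨fun h => hττ.injective (h.trans hτz.symm), fun h => h ▸ hτz⟩
      have h0 : τ v = 0 ↔ v = 0 := ⟨fun h => hττ.injective (h.trans (map_zero τ).symm),
        fun h => h ▸ map_zero τ⟩
      simp only [g, ind_isometry hτB hτz, h0, h1]
    · have h1 : ∀ w, sgn F (B v w) * g w = ind F B z w * sgn F (B v w) -
          ((if w = 0 then sgn F (B v w) else 0) + if w = z then sgn F (B v w) else 0) := by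
        intro w
        simp only [g]
        split_ifs <;> ring
      rw [sum_adjacency hv hgsupp, hgsum, fourier_apply_of_support hv hgsupp]
      simp only [h1, Finset.sum_sub_distrib, Finset.sum_add_distrib, sum_ind_mul_sgn hnd hB,
        Finset.sum_ite_eq', Finset.mem_univ, if_true, map_zero, hv, sgn_zero]
      simp only [g, ind, hv, if_true]
      linear_combination (1 - ((if v = 0 then (1 : F) else 0) + if v = z then 1 else 0)) / 8 * hη
  have hgs0 : ∑ w, g w ≠ 0 := by
    rw [hgsum]
    intro h
    exact hN4 (by linear_combination 2 * h)
  refine finrank_eq_one_iff'.mpr ⟨⟨g, hg⟩, ?_, ?_⟩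
  · intro h
    have : g = 0 := congrArg Subtype.val h
    exact hgs0 (by simp [this])
  · rintro ⟨f, hf⟩
    refine ⟨(∑ w, f w) / ∑ w, g w, Subtype.ext ?_⟩
    set a := (∑ w, f w) / ∑ w, g w with ha
    -- The difference has sum zero. Were it nonzero, then `η² |V| = 16`, which together with `η |V|
    -- = -8` gives `|V| = 4`.
    have hk : f - a • g ∈ radFunctions B z τ η := sub_mem hf (Submodule.smul_mem _ _ hg)
    have hks : ∑ w, (f - a • g) w = 0 := by
      simp only [Pi.sub_apply, Pi.smul_apply, smul_eq_mul, Finset.sum_sub_distrib,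
        ← Finset.mul_sum]
      rw [ha, div_mul_cancel₀ _ hgs0, sub_self]
    by_contra hne
    have hk0 : f - a • g ≠ 0 := fun h => hne (sub_eq_zero.mp h).symm
    have h16 := sq_mul_card_eq hnd hB hη0 hk hks hk0
    refine hN4 ?_
    linear_combination (Fintype.card V : F) / 16 * (-h16) + (η * Fintype.card V - 8) / 16 * hη

/-- With `η c = 4` and `c² = |V|` the factor `8 + η |V|` is `4 (c + 2)`, so `c ≠ -2` makes `∑ f`
vanish. Conversely, an eigenfunction has `∑ f = Φ f 0 = c f 0`. -/
theorem mem_radFunctions_iff (hnd : B.Nondegenerate) (hB : B.IsAlt) (hz : z ≠ 0) {c : F}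
    (hc : c ^ 2 = Fintype.card V) (hηc : η * c = 4) (hc2 : c ≠ -2) :
    f ∈ radFunctions B z τ η ↔ f ∈ eigenFunctions B z τ c ∧ f 0 = 0 := by
  have hη : η ≠ 0 := by rintro rfl; norm_num at hηc
  have hc4 : 4 / η = c := by rw [← hηc]; field_simp
  constructor
  · intro hf
    have hs : ∑ w, f w = 0 := by
      refine (mul_eq_zero.mp (radFunctions_sum hnd hB hz hf)).resolve_right fun h => hc2 ?_
      rw [← hc] at h
      linear_combination h / 4 - c / 4 * hηc
    refine ⟨⟨hf.2.1, radFunctions_add hB hf, hf.2.2.1, ?_⟩, hf.1⟩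
    rw [radFunctions_eigen hη hf hs, hc4]
  · rintro ⟨hf, h0⟩
    refine ⟨h0, hf.1, hf.2.2.1, fun v hv => ?_⟩
    rw [sum_adjacency hv hf.1, ← fourier_zero (B := B) (z := z) hf.1, hf.2.2.2]
    simp only [Pi.smul_apply, smul_eq_mul, h0]
    linear_combination -f v / 4 * hηc

/-- The trace of a projection is the dimension of its image, as an element of `F`; the cast is
harmless in characteristic `0`. -/
theorem finrank_eigenFunctions (hnd : B.Nondegenerate) (hB : B.IsAlt) (hz : z ≠ 0)
    (hτB : ∀ u v, B (τ u) (τ v) = B u v) (hττ : Function.Involutive τ) (hτz : τ z = z)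
    (hτH : ∀ v, B (τ v) v = B v z) {c : F} (hc : c ^ 2 = Fintype.card V) :
    (finrank F (eigenFunctions B z τ c) : F) = (c ^ 2 / 2 +
      (Finset.univ.filter fun v => B v z = 0 ∧ τ v = v).card +
      (Finset.univ.filter fun v => B v z = 0 ∧ τ v = v + z).card) / 8 + c / 4 := by
  have hc0 : c ≠ 0 := by
    rintro rfl
    have : (Fintype.card V : F) ≠ 0 := Nat.cast_ne_zero.mpr Fintype.card_ne_zero
    exact this (by rw [← hc]; simp)
  have h := (isProj_eigenProj hnd hB hτB hττ hτz hc).trace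
  have hH : ((Finset.univ.filter fun v => B v z = 0).card : F) = c ^ 2 / 2 := by
    rw [hc, ← sum_ind hnd hB hz]
    simp [ind]
  rw [← h, trace_eigenProj hB hz hτB hτz hτH, hH]
  congr 1
  field_simp
  norm_num

theorem finrank_radFunctions_add_one (hnd : B.Nondegenerate) (hB : B.IsAlt) (hz : z ≠ 0)
    (hτB : ∀ u v, B (τ u) (τ v) = B u v) (hττ : Function.Involutive τ) (hτz : τ z = z)
    {c : F} (hc : c ^ 2 = Fintype.card V) (hηc : η * c = 4) (hc2 : c ≠ -2) :
    finrank F (radFunctions B z τ η) + 1 = finrank F (eigenFunctions B z τ c) := by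
  have hc0 : c ≠ 0 := by rintro rfl; norm_num at hηc
  let φ : Dual F (eigenFunctions B z τ c) := LinearMap.proj 0 ∘ₗ Submodule.subtype _
  -- Evaluation at `0` is tested on the projection of the delta function at `0`, where it takes the
  -- value `1/4 + 1/(2c) = (c + 2)/(4c)`.
  have hφ : φ ≠ 0 := by
    intro h
    have h1 := LinearMap.congr_fun h ⟨eigenProj B z τ c (Pi.single 0 1),
      (isProj_eigenProj hnd hB hτB hττ hτz hc).map_mem _⟩
    change eigenProj B z τ c (Pi.single 0 1) 0 = 0 at h1
    rw [eigenProj_apply] at h1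
    simp only [fourier_single, map_zero, zero_add, Pi.single_apply, if_true, hz, if_false, ind,
      LinearMap.zero_apply, sgn_zero] at h1
    field_simp at h1
    refine hc2 ?_
    linear_combination h1 / 8
  have hmap : radFunctions B z τ η = (LinearMap.ker φ).map (Submodule.subtype _) := by
    ext f
    rw [mem_radFunctions_iff hnd hB hz hc hηc hc2, Submodule.mem_map]
    constructor
    · rintro ⟨hf, h0⟩
      exact ⟨⟨f, hf⟩, h0, rfl⟩
    · rintro ⟨⟨f, hf⟩, h0, rfl⟩
      exact ⟨hf, h0⟩
  rw [hmap, ← (Submodule.equivMapOfInjective _ (Submodule.injective_subtype _) _).finrank_eq,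
    Module.Dual.finrank_ker_add_one_of_ne_zero hφ]

end Radical

end SymplecticFunctions

/-! ### The geometry of `τ`: fixed and translated vectors, rank and type -/

namespace Symplectic

variable {V : Type*} [AddCommGroup V] [Module (ZMod 2) V]
  {B : LinearMap.BilinForm (ZMod 2) V}

section Tau

variable {m : ℕ} {e : Fin m → V}

theorem tau_involutive (hB : B.IsAlt) (he : ∀ i j, B (e i) (e j) = 0) :
    Function.Involutive (tau hB e : V ≃ₗ[ZMod 2] V) := fun v => by
  rw [← coe_mul_apply, tau_mul_self hB e he, coe_one_apply]

theorem tau_sum (hB : B.IsAlt) (he : ∀ i j, B (e i) (e j) = 0) :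
    (tau hB e : V ≃ₗ[ZMod 2] V) (∑ i, e i) = ∑ i, e i := by
  rw [tau_apply hB e he]
  simp [he, LinearMap.sum_apply]

/-- The left side is `∑ (v, e i)²`, and squaring is the identity on `𝔽₂`. This is where the vector
`z` comes from. -/
theorem form_tau_self (hB : B.IsAlt) (he : ∀ i j, B (e i) (e j) = 0) (v : V) :
    B ((tau hB e : V ≃ₗ[ZMod 2] V) v) v = B v (∑ i, e i) := by
  rw [tau_apply hB e he, map_add, LinearMap.add_apply, hB v, zero_add, map_sum, map_sum,
    LinearMap.sum_apply]
  refine Finset.sum_congr rfl fun i _ => ?_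
  rw [map_smul, LinearMap.smul_apply, symm_of_alt hB (e i), smul_eq_mul]
  rcases zmod_cases (B v (e i)) with h | h <;> simp [h]

theorem sum_ne_zero_of_linearIndependent (hm : 0 < m) (hli : LinearIndependent (ZMod 2) e) :
    ∑ i, e i ≠ 0 := by
  intro h
  have := Fintype.linearIndependent_iff.mp hli (fun _ => 1) (by simpa using h) ⟨0, hm⟩
  exact one_ne_zero this

/-- The coordinates `((v, e₁), …, (v, eₘ))` of a vector `v`. -/
def pairing (B : LinearMap.BilinForm (ZMod 2) V) (e : Fin m → V) :
    V →ₗ[ZMod 2] (Fin m → ZMod 2) :=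
  LinearMap.pi fun i => B.flip (e i)

theorem pairing_apply (v : V) (i : Fin m) : pairing B e v i = B v (e i) := rfl

theorem pairing_surjective [FiniteDimensional (ZMod 2) V] (hnd : B.Nondegenerate)
    (hli : LinearIndependent (ZMod 2) e) : Function.Surjective (pairing B e) := by
  intro c
  -- Prescribe a functional on the span of the `e i`, extend it to `V`, and represent it by a vector
  -- through the nondegenerate form.
  obtain ⟨f, hf⟩ := LinearMap.exists_extend ((Basis.span hli).constr (ZMod 2) c)
  refine ⟨(B.toDual hnd).symm f, funext fun i => ?_⟩
  rw [pairing_apply, LinearMap.BilinForm.apply_toDual_symm_apply]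
  have h := LinearMap.congr_fun hf (Basis.span hli i)
  rw [Basis.constr_basis, LinearMap.comp_apply, Submodule.subtype_apply, Basis.span_apply] at h
  exact h

theorem tau_eq_self_iff (hB : B.IsAlt) (he : ∀ i j, B (e i) (e j) = 0)
    (hli : LinearIndependent (ZMod 2) e) (v : V) :
    (tau hB e : V ≃ₗ[ZMod 2] V) v = v ↔ pairing B e v = 0 := by
  rw [tau_apply hB e he, add_eq_left]
  refine ⟨fun h => funext fun i => Fintype.linearIndependent_iff.mp hli _ h i, fun h => ?_⟩
  refine Finset.sum_eq_zero fun i _ => ?_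
  rw [← pairing_apply, h, Pi.zero_apply, zero_smul]

theorem tau_eq_add_sum_iff (hB : B.IsAlt) (he : ∀ i j, B (e i) (e j) = 0)
    (hli : LinearIndependent (ZMod 2) e) (v : V) :
    (tau hB e : V ≃ₗ[ZMod 2] V) v = v + ∑ i, e i ↔ pairing B e v = 1 := by
  rw [tau_apply hB e he, add_right_inj]
  constructor
  · intro h
    have h1 : ∑ i, (B v (e i) - 1) • e i = 0 := by
      simp only [sub_smul, one_smul, Finset.sum_sub_distrib, h, sub_self]
    exact funext fun i => sub_eq_zero.mp (Fintype.linearIndependent_iff.mp hli _ h1 i)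
  · intro h
    refine Finset.sum_congr rfl fun i _ => ?_
    rw [← pairing_apply, h, Pi.one_apply, one_smul]

variable [FiniteDimensional (ZMod 2) V]

theorem finrank_ker_pairing (hV : finrank (ZMod 2) V = 2 * m) (hnd : B.Nondegenerate)
    (hli : LinearIndependent (ZMod 2) e) : finrank (ZMod 2) (LinearMap.ker (pairing B e)) = m := by
  have h := LinearMap.finrank_range_add_finrank_ker (pairing B e)
  rw [LinearMap.range_eq_top.mpr (pairing_surjective hnd hli), finrank_top, hV] at h
  simp at h
  omega

theorem card_pairing_fiber [Fintype V] (hV : finrank (ZMod 2) V = 2 * m) (hnd : B.Nondegenerate)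
    (hli : LinearIndependent (ZMod 2) e) (c : Fin m → ZMod 2) :
    (Finset.univ.filter fun v => pairing B e v = c).card = 2 ^ m := by
  classical
  have h0 : (Finset.univ.filter fun v => pairing B e v = 0).card = 2 ^ m := by
    have h := Module.card_eq_pow_finrank (K := ZMod 2) (V := LinearMap.ker (pairing B e))
    rw [finrank_ker_pairing hV hnd hli, ZMod.card] at h
    rw [← h, ← Fintype.card_subtype]
    exact Fintype.card_congr (Equiv.refl _)
  obtain ⟨v₀, rfl⟩ := pairing_surjective hnd hli c
  rw [← h0]
  refine Finset.card_equiv (Equiv.subRight v₀) fun v => ?_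
  simp [sub_eq_zero]

theorem form_sum (v : V) : B v (∑ i, e i) = ∑ i, pairing B e v i := by
  rw [map_sum]; rfl

theorem card_fixed [Fintype V] [DecidableEq V] (hV : finrank (ZMod 2) V = 2 * m) (hB : B.IsAlt)
    (hnd : B.Nondegenerate) (he : ∀ i j, B (e i) (e j) = 0)
    (hli : LinearIndependent (ZMod 2) e) :
    (Finset.univ.filter fun v => B v (∑ i, e i) = 0 ∧
      (tau hB e : V ≃ₗ[ZMod 2] V) v = v).card = 2 ^ m := by
  rw [← card_pairing_fiber hV hnd hli 0]
  congr 1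
  ext v
  simp only [Finset.mem_filter, Finset.mem_univ, true_and, tau_eq_self_iff hB he hli,
    and_iff_right_iff_imp]
  intro h
  rw [form_sum, h]
  simp

/-- Such `v` have all `(v, e i) = 1`, so that `(v, z) = m` in `𝔽₂`: the whole coset lies in `z⊥` for
even `m` and misses it for odd `m`. -/
theorem card_translated [Fintype V] [DecidableEq V] (hV : finrank (ZMod 2) V = 2 * m)
    (hB : B.IsAlt) (hnd : B.Nondegenerate) (he : ∀ i j, B (e i) (e j) = 0)
    (hli : LinearIndependent (ZMod 2) e) :
    (Finset.univ.filter fun v => B v (∑ i, e i) = 0 ∧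
      (tau hB e : V ≃ₗ[ZMod 2] V) v = v + ∑ i, e i).card = if Odd m then 0 else 2 ^ m := by
  have h : ∀ v, pairing B e v = 1 → (B v (∑ i, e i) = 0 ↔ Even m) := by
    intro v hv
    rw [form_sum, hv]
    simp [ZMod.natCast_eq_zero_iff_even]
  split_ifs with hm
  · rw [Finset.card_eq_zero, Finset.filter_eq_empty_iff]
    rintro v - ⟨h1, h2⟩
    rw [tau_eq_add_sum_iff hB he hli] at h2
    exact (Nat.not_even_iff_odd.mpr hm) ((h v h2).mp h1)
  · rw [← card_pairing_fiber hV hnd hli 1]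
    congr 1
    ext v
    simp only [Finset.mem_filter, Finset.mem_univ, true_and, tau_eq_add_sum_iff hB he hli,
      and_iff_right_iff_imp]
    exact fun h1 => (h v h1).mpr (Nat.not_odd_iff_even.mp hm)

theorem flipRank_tau (hV : finrank (ZMod 2) V = 2 * m) (hB : B.IsAlt) (hnd : B.Nondegenerate)
    (he : ∀ i j, B (e i) (e j) = 0) (hli : LinearIndependent (ZMod 2) e) :
    flipRank (tau hB e) = m := by
  have h := LinearMap.finrank_range_add_finrank_ker
    ((tau hB e : V ≃ₗ[ZMod 2] V).toLinearMap - LinearMap.id)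
  have hk : LinearMap.ker ((tau hB e : V ≃ₗ[ZMod 2] V).toLinearMap - LinearMap.id) =
      LinearMap.ker (pairing B e) := by
    ext v
    rw [LinearMap.mem_ker, LinearMap.mem_ker, ← tau_eq_self_iff hB he hli]
    exact sub_eq_zero
  rw [hk, finrank_ker_pairing hV hnd hli, hV] at h
  unfold flipRank
  omega

theorem isTypeOne_tau (hm : 0 < m) (hB : B.IsAlt) (hnd : B.Nondegenerate)
    (he : ∀ i j, B (e i) (e j) = 0) (hli : LinearIndependent (ZMod 2) e) :
    IsTypeOne (tau hB e) := by
  refine ⟨LinearMap.ker (B.flip (∑ i, e i)), LinearMap.isCoatom_ker_of_surjective ?_, fun v => ?_⟩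
  · refine LinearMap.surjective fun h => ?_
    obtain ⟨u, hu⟩ := exists_form_eq_one hnd (sum_ne_zero_of_linearIndependent hm hli)
    have := LinearMap.congr_fun h u
    change B u (∑ i, e i) = 0 at this
    rw [hu] at this
    exact one_ne_zero this
  · rw [symm_of_alt hB v, form_tau_self hB he]
    exact LinearMap.mem_ker

end Tau

end Symplectic

/-! ### The Matsuo algebra in coordinates on `V`, and its Frobenius form -/

namespace Symplectic

open MatsuoAlgebra

variable {F : Type*} [Field F] (η : F) {V : Type*} [AddCommGroup V] [Module (ZMod 2) V]
  {B : LinearMap.BilinForm (ZMod 2) V} [FiniteDimensional (ZMod 2) V] (hB : B.IsAlt)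
  (hnd : B.Nondegenerate)

/-- The transvection with nonzero centre `v` as a point. -/
def point (v : V) (hv : v ≠ 0) : (threeTranspositionGroup hB hnd).D :=
  ⟨transvection hB v, v, hv, rfl⟩

theorem exists_eq_point (c : (threeTranspositionGroup hB hnd).D) :
    ∃ v hv, c = point hB hnd v hv := by
  obtain ⟨_, v, hv, rfl⟩ := c
  exact ⟨v, hv, rfl⟩

theorem point_inj {v w : V} (hv : v ≠ 0) (hw : w ≠ 0) :
    point hB hnd v hv = point hB hnd w hw ↔ v = w := by
  refine ⟨fun h => transvection_injective hB hnd hv (congrArg Subtype.val h), ?_⟩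
  rintro rfl
  rfl

theorem transvection_inv (v : V) : (transvection hB v)⁻¹ = transvection hB v :=
  inv_eq_of_mul_eq_one_left (transvection_mul_self hB v)

/-- Conjugation gives `(r_v r_w)² = r_{w + (v, w) v} r_w`, which is trivial exactly when `(v, w) =
0`. -/
theorem orderOf_transvection_mul (hnd : B.Nondegenerate) {v w : V} (hv : v ≠ 0) (hvw : v ≠ w) :
    orderOf (transvection hB v * transvection hB w) = 2 ↔ B v w = 0 := by
  have h1 := conj_transvection hB (transvection hB v) w
  rw [transvection_apply, transvection_inv, symm_of_alt hB w v] at h1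
  have hsq : (transvection hB v * transvection hB w) ^ 2 =
      transvection hB (w + B v w • v) * transvection hB w := by
    rw [← h1, pow_two, ← mul_assoc]
  constructor
  · intro h
    by_contra h0
    have h2 := pow_orderOf_eq_one (transvection hB v * transvection hB w)
    rw [h, hsq, (zmod_cases (B v w)).resolve_left h0, one_smul] at h2
    have h3 := eq_inv_of_mul_eq_one_left h2
    rw [transvection_inv] at h3
    by_cases hw : w = 0
    · exact h0 (by rw [hw, map_zero])
    · exact hv (left_eq_add.mp (transvection_injective hB hnd hw h3.symm))
  · intro h
    refine orderOf_eq_prime ?_ fun h2 => ?_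
    · rw [hsq, h, zero_smul, add_zero, transvection_mul_self]
    · have h3 := eq_inv_of_mul_eq_one_left h2
      rw [transvection_inv] at h3
      exact hvw (transvection_injective hB hnd hv h3)

open Classical in
/-- The axis of the transvection with centre `v`, extended by `0` at `v = 0`. -/
noncomputable def ax (v : V) : MatsuoAlgebra η (threeTranspositionGroup hB hnd) :=
  if h : v = 0 then 0 else axis η (point hB hnd v h)

theorem ax_zero : ax η hB hnd 0 = 0 := dif_pos rfl

theorem ax_of_ne_zero {v : V} (hv : v ≠ 0) : ax η hB hnd v = axis η (point hB hnd v hv) :=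
  dif_neg hv

theorem axis_mul_axis {G : Type*} [Group G] {T : ThreeTranspositionGroup G} (c d : T.D) :
    axis η c * axis η d = axisMul η c d := by
  have h : mulLin η T (axis η c) = (Finsupp.linearCombination F fun d => axisMul η c d :
      MatsuoAlgebra η T →ₗ[F] MatsuoAlgebra η T) :=
    (Finsupp.linearCombination_single F 1 c).trans (one_smul _ _)
  change mulLin η T (axis η c) (axis η d) = _
  rw [h]
  exact (Finsupp.linearCombination_single F 1 d).trans (one_smul _ _)

theorem form_axis_axis {G : Type*} [Group G] {T : ThreeTranspositionGroup G} (c d : T.D) :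
    form η T (axis η c) (axis η d) = axisForm η c d := by
  have h : form η T (axis η c) = (Finsupp.linearCombination F fun d => axisForm η c d :
      MatsuoAlgebra η T →ₗ[F] F) :=
    (Finsupp.linearCombination_single F 1 c).trans (one_smul _ _)
  rw [h]
  exact (Finsupp.linearCombination_single F 1 d).trans (one_smul _ _)

theorem conj_point {v w : V} (hv : v ≠ 0) (hw : w ≠ 0) (h : B v w ≠ 0) (h0 : v + w ≠ 0) :
    (threeTranspositionGroup hB hnd).conj (point hB hnd v hv) (point hB hnd w hw) =
      point hB hnd (v + w) h0 := by
  apply Subtype.ext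
  change (transvection hB w)⁻¹ * transvection hB v * transvection hB w = transvection hB (v + w)
  have h1 := conj_transvection hB (transvection hB w) v
  rw [transvection_apply, (zmod_cases (B v w)).resolve_left h, one_smul, transvection_inv] at h1
  rw [transvection_inv, h1]

variable [DecidableEq V]

theorem ax_mul_ax (v w : V) : ax η hB hnd v * ax η hB hnd w =
    if v = w then ax η hB hnd v else if B v w = 0 then 0 else
      (η / 2) • (ax η hB hnd v + ax η hB hnd w - ax η hB hnd (v + w)) := by
  by_cases hv : v = 0
  · subst hv
    simp [ax_zero]
  by_cases hw : w = 0
  · subst hw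
    simp [ax_zero, hv]
  rw [ax_of_ne_zero η hB hnd hv, ax_of_ne_zero η hB hnd hw, axis_mul_axis, axisMul]
  by_cases hvw : v = w
  · rw [if_pos hvw, if_pos ((point_inj hB hnd hv hw).mpr hvw)]
  rw [if_neg hvw, if_neg (mt (point_inj hB hnd hv hw).mp hvw)]
  have h : orderOf ((point hB hnd v hv : Sp B) * point hB hnd w hw) = 2 ↔ B v w = 0 :=
    orderOf_transvection_mul hB hnd hv hvw
  by_cases h0 : B v w = 0
  · rw [if_pos h0, if_pos (h.mpr h0)]
  · have hs : v + w ≠ 0 := fun hs => hvw ((SymplecticFunctions.add_eq_zero_iff v w).mp hs)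
    rw [if_neg h0, if_neg (fun h1 => h0 (h.mp h1)), conj_point hB hnd hv hw h0 hs,
      ax_of_ne_zero η hB hnd hs]

theorem form_ax_ax (v w : V) : form η _ (ax η hB hnd v) (ax η hB hnd w) =
    if v = w then (if v = 0 then 0 else 1) else if B v w = 0 then 0 else η / 2 := by
  by_cases hv : v = 0
  · subst hv
    simp [ax_zero]
  by_cases hw : w = 0
  · subst hw
    simp [ax_zero, hv]
  rw [ax_of_ne_zero η hB hnd hv, ax_of_ne_zero η hB hnd hw, form_axis_axis, axisForm]
  by_cases hvw : v = w
  · rw [if_pos hvw, if_neg hv, if_pos ((point_inj hB hnd hv hw).mpr hvw)]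
  · rw [if_neg hvw, if_neg (mt (point_inj hB hnd hv hw).mp hvw)]
    exact if_congr (orderOf_transvection_mul hB hnd hv hvw) rfl rfl

variable {η hB hnd}

theorem linearMap_ext {N : Type*} [AddCommGroup N] [Module F N]
    {f g : MatsuoAlgebra η (threeTranspositionGroup hB hnd) →ₗ[F] N}
    (h : ∀ v, f (ax η hB hnd v) = g (ax η hB hnd v)) : f = g := by
  refine Finsupp.lhom_ext' fun c => LinearMap.ext_ring ?_
  obtain ⟨v, hv, rfl⟩ := exists_eq_point hB hnd c
  have := h v
  rwa [ax_of_ne_zero η hB hnd hv] at this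

theorem span_range_ax : Submodule.span F (Set.range (ax η hB hnd)) = ⊤ := by
  rw [← LinearMap.range_id, ← Submodule.map_top]
  refine le_antisymm (by simp) ?_
  rintro x -
  rw [← Submodule.Quotient.mk_eq_zero]
  have h : (Submodule.span F (Set.range (ax η hB hnd))).mkQ = 0 := by
    refine linearMap_ext fun v => ?_
    rw [Submodule.mkQ_apply, LinearMap.zero_apply, Submodule.Quotient.mk_eq_zero]
    exact Submodule.subset_span ⟨v, rfl⟩
  exact LinearMap.congr_fun h x

theorem ax_induction {p : MatsuoAlgebra η (threeTranspositionGroup hB hnd) → Prop}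
    (ax : ∀ v, p (ax η hB hnd v)) (add : ∀ x y, p x → p y → p (x + y))
    (smul : ∀ (a : F) x, p x → p (a • x)) (x) : p x := by
  have hx : x ∈ Submodule.span F (Set.range (Symplectic.ax η hB hnd)) := by
    rw [span_range_ax]; exact Submodule.mem_top
  induction hx using Submodule.span_induction with
  | mem x hx => obtain ⟨v, rfl⟩ := hx; exact ax v
  | zero => have := ax 0; rwa [ax_zero] at this
  | add x y _ _ hx hy => exact add x y hx hy
  | smul a x _ hx => exact smul a x hx

variable (η hB hnd) in
open Classical in
/-- The coefficients of an element of the Matsuo algebra with respect to the axes `ax v`. -/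
noncomputable def coords : MatsuoAlgebra η (threeTranspositionGroup hB hnd) →ₗ[F] (V → F) where
  toFun x v := if h : v = 0 then 0 else
    DFunLike.coe (F := (threeTranspositionGroup hB hnd).D →₀ F) x (point hB hnd v h)
  map_add' x y := by
    ext v
    by_cases h : v = 0
    · simp [h]
    · simp only [Pi.add_apply, dif_neg h]; rfl
  map_smul' a x := by
    ext v
    by_cases h : v = 0
    · simp [h]
    · simp only [Pi.smul_apply, dif_neg h]; rfl

theorem coords_apply (x : MatsuoAlgebra η (threeTranspositionGroup hB hnd)) {v : V} (hv : v ≠ 0) :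
    coords η hB hnd x v =
      DFunLike.coe (F := (threeTranspositionGroup hB hnd).D →₀ F) x (point hB hnd v hv) :=
  dif_neg hv

theorem coords_zero_apply (x : MatsuoAlgebra η (threeTranspositionGroup hB hnd)) :
    coords η hB hnd x 0 = 0 := by
  exact dif_pos rfl

theorem coords_ax (v w : V) : coords η hB hnd (ax η hB hnd v) w =
    if v = w then (if v = 0 then 0 else 1) else 0 := by
  by_cases hw : w = 0
  · subst hw
    rw [coords_zero_apply]
    split_ifs <;> rfl
  by_cases hv : v = 0
  · subst hv
    simp [ax_zero]
  rw [ax_of_ne_zero η hB hnd hv]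
  rw [coords_apply _ hw, if_neg hv, axis]
  classical
  refine Finsupp.single_apply.trans ?_
  exact if_congr (point_inj hB hnd hv hw) rfl rfl

variable [Fintype V]

theorem sum_coords (x : MatsuoAlgebra η (threeTranspositionGroup hB hnd)) :
    ∑ v, coords η hB hnd x v • ax η hB hnd v = x := by
  have h : (∑ v, (LinearMap.proj v ∘ₗ coords η hB hnd).smulRight (ax η hB hnd v)) =
      (LinearMap.id : _ →ₗ[F] MatsuoAlgebra η (threeTranspositionGroup hB hnd)) := by
    refine linearMap_ext fun w => ?_
    simp only [LinearMap.sum_apply, LinearMap.smulRight_apply, LinearMap.comp_apply,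
      LinearMap.proj_apply, coords_ax, LinearMap.id_apply, ite_smul, zero_smul,
      Finset.sum_ite_eq, Finset.mem_univ, if_true]
    split_ifs with h
    · rw [h, ax_zero]
    · rw [one_smul]
  simpa using LinearMap.congr_fun h x

theorem coords_injective : Function.Injective (coords η hB hnd) := fun x y h => by
  rw [← sum_coords x, h, sum_coords]

theorem coords_sum {f : V → F} (hf : f 0 = 0) :
    coords η hB hnd (∑ v, f v • ax η hB hnd v) = f := by
  ext w
  simp only [map_sum, map_smul, Finset.sum_apply, Pi.smul_apply, coords_ax, smul_eq_mul, mul_ite,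
    mul_zero, mul_one, Finset.sum_ite_eq', Finset.mem_univ, if_true]
  split_ifs with h
  · rw [h, hf]
  · rfl

theorem coords_mul (x y : MatsuoAlgebra η (threeTranspositionGroup hB hnd)) (u : V) :
    coords η hB hnd (x * y) u = ∑ v, ∑ w, coords η hB hnd x v * coords η hB hnd y w *
      coords η hB hnd (ax η hB hnd v * ax η hB hnd w) u := by
  conv_lhs => rw [← sum_coords x, ← sum_coords y]
  simp only [Finset.sum_mul_sum, smul_mul_smul_comm, map_sum, map_smul, Finset.sum_apply,
    Pi.smul_apply, smul_eq_mul]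

theorem form_ax_apply (v : V) (x : MatsuoAlgebra η (threeTranspositionGroup hB hnd)) :
    form η _ (ax η hB hnd v) x = ∑ w, coords η hB hnd x w *
      form η _ (ax η hB hnd v) (ax η hB hnd w) := by
  conv_lhs => rw [← sum_coords x]
  simp only [map_sum, map_smul, smul_eq_mul]

theorem form_ax_eq [CharZero F] {v : V} (hv : v ≠ 0)
    (x : MatsuoAlgebra η (threeTranspositionGroup hB hnd)) :
    form η _ (ax η hB hnd v) x = coords η hB hnd x v +
      η / 2 * ∑ w, (1 - SymplecticFunctions.sgn F (B v w)) / 2 * coords η hB hnd x w := by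
  have h : ∀ w, coords η hB hnd x w * form η _ (ax η hB hnd v) (ax η hB hnd w) =
      (if v = w then coords η hB hnd x w else 0) +
      η / 2 * ((1 - SymplecticFunctions.sgn F (B v w)) / 2 * coords η hB hnd x w) := by
    intro w
    rw [form_ax_ax, if_neg hv]
    by_cases hvw : v = w
    · subst hvw; simp [hB v]
    · rw [if_neg hvw, if_neg hvw]
      rcases zmod_cases (B v w) with h | h
      · simp [h]
      · simp only [h, one_ne_zero, if_false, SymplecticFunctions.sgn_one]; ring
  rw [form_ax_apply]
  simp only [h, Finset.sum_add_distrib, Finset.sum_ite_eq, Finset.mem_univ, if_true,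
    ← Finset.mul_sum]

theorem mul_comm' (x y : MatsuoAlgebra η (threeTranspositionGroup hB hnd)) : x * y = y * x := by
  induction x using ax_induction with
  | add x x' h h' => rw [add_mul, mul_add, h, h']
  | smul a x h => rw [smul_mul_assoc, mul_smul_comm, h]
  | ax v =>
    induction y using ax_induction with
    | add y y' h h' => rw [add_mul, mul_add, h, h']
    | smul a y h => rw [smul_mul_assoc, mul_smul_comm, h]
    | ax w =>
      rw [ax_mul_ax, ax_mul_ax]
      by_cases hvw : v = w
      · subst hvw; rfl
      · rw [if_neg hvw, if_neg (Ne.symm hvw), symm_of_alt hB w v, add_comm (ax η hB hnd v),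
          add_comm v]

/-- Associativity of the form on axes. The cases are the coincidences among `v`, `w`, `u` and the
line `v + w = u`; away from these, the values `(v, w)`, `(w, u)`, `(v, u)` decide both sides. -/
theorem form_ax_mul_ax (v w u : V) :
    form η _ (ax η hB hnd v * ax η hB hnd w) (ax η hB hnd u) =
      form η _ (ax η hB hnd v) (ax η hB hnd w * ax η hB hnd u) := by
  by_cases hv : v = 0
  · simp [hv, ax_zero]
  by_cases hw : w = 0
  · simp [hw, ax_zero]
  by_cases hu : u = 0
  · simp [hu, ax_zero]
  rw [ax_mul_ax, ax_mul_ax]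
  by_cases hvw : v = w
  · subst hvw
    by_cases hvu : v = u
    · subst hvu
      simp
    · have h1 : v ≠ v + u := by simpa using hu
      rcases zmod_cases (B v u) with h | h
      · simp [form_ax_ax, hvu, h]
      · simp [form_ax_ax, hvu, h, h1, hv, hB v]
  by_cases hwu : w = u
  · subst hwu
    have h1 : v + w ≠ w := by simpa using hv
    rcases zmod_cases (B v w) with h | h
    · simp [form_ax_ax, hvw, h]
    · simp [form_ax_ax, hvw, h, h1, hw, hB w]
  by_cases hvu : v = u
  · subst hvu
    have h1 : v + w ≠ v := by simpa using hw
    have h2 : v ≠ w + v := by simpa using hw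
    rcases zmod_cases (B v w) with h | h
    · simp [hvw, hwu, h, symm_of_alt hB w v]
    · simp [form_ax_ax, hvw, hwu, h, symm_of_alt hB w v, h1, h2, hv, hB v]
  by_cases hs : v + w = u
  · subst hs
    have h2 : w + (v + w) = v := by
      rw [add_comm, SymplecticFunctions.add_add_cancel]
    rcases zmod_cases (B v w) with h | h
    · simp [hvw, h, symm_of_alt hB w v, hB w, hv]
    · simp [form_ax_ax, hvw, hwu, hvu, h, symm_of_alt hB w v, h2, hv, hu, hB v, hB w]
  · have h2 : v ≠ w + u := by
      rintro rfl
      exact hs (by rw [add_comm w, SymplecticFunctions.add_add_cancel])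
    rcases zmod_cases (B v w) with h | h <;> rcases zmod_cases (B w u) with h' | h' <;>
      rcases zmod_cases (B v u) with h'' | h'' <;>
      simp [form_ax_ax, hvw, hwu, hvu, h, h', h'', hs, h2]

theorem form_mul (x y t : MatsuoAlgebra η (threeTranspositionGroup hB hnd)) :
    form η _ (x * y) t = form η _ x (y * t) := by
  induction x using ax_induction with
  | add x x' h h' => simp only [add_mul, map_add, LinearMap.add_apply, h, h']
  | smul a x h => simp only [smul_mul_assoc, map_smul, LinearMap.smul_apply, h]
  | ax v =>
    induction y using ax_induction with
    | add x x' h h' => simp only [add_mul, mul_add, map_add, LinearMap.add_apply, h, h']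
    | smul a x h => simp only [smul_mul_assoc, mul_smul_comm, map_smul, LinearMap.smul_apply, h]
    | ax w =>
      induction t using ax_induction with
      | add x x' h h' => simp only [mul_add, map_add, h, h']
      | smul a x h => simp only [mul_smul_comm, map_smul, h]
      | ax u => exact form_ax_mul_ax v w u

end Symplectic

/-! ### The flip subalgebra as invariant functions on `z⊥`, and its radical -/

namespace Symplectic

open MatsuoAlgebra SymplecticFunctions

variable {F : Type*} [Field F] {η : F} {V : Type*} [AddCommGroup V] [Module (ZMod 2) V]
  {B : LinearMap.BilinForm (ZMod 2) V} [FiniteDimensional (ZMod 2) V] {hB : B.IsAlt}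
  {hnd : B.Nondegenerate} {σ : (threeTranspositionGroup hB hnd).Flip} {t : Sp B}
  {z : V}

theorem act_point (hσ : σ.toMulAut = MulAut.conj t) {v : V} (hv : v ≠ 0) :
    σ.act (point hB hnd v hv) = point hB hnd ((t : V ≃ₗ[ZMod 2] V) v)
      ((LinearEquiv.map_ne_zero_iff _).mpr hv) := by
  apply Subtype.ext
  change σ.toMulAut (transvection hB v) = transvection hB ((t : V ≃ₗ[ZMod 2] V) v)
  rw [hσ, MulAut.conj_apply, conj_transvection]

theorem axis_act (hσ : σ.toMulAut = MulAut.conj t) {v : V} (hv : v ≠ 0) :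
    axis η (σ.act (point hB hnd v hv)) = ax η hB hnd ((t : V ≃ₗ[ZMod 2] V) v) := by
  rw [act_point hσ, ← ax_of_ne_zero]

theorem mem_singles_iff (hσ : σ.toMulAut = MulAut.conj t)
    (x : MatsuoAlgebra η (threeTranspositionGroup hB hnd)) :
    x ∈ singles η σ ↔ ∃ v, v ≠ 0 ∧ (t : V ≃ₗ[ZMod 2] V) v = v ∧ x = ax η hB hnd v := by
  constructor
  · rintro ⟨c, hc, rfl⟩
    obtain ⟨v, hv, rfl⟩ := exists_eq_point hB hnd c
    rw [act_point hσ, point_inj] at hc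
    exact ⟨v, hv, hc, (ax_of_ne_zero η hB hnd hv).symm⟩
  · rintro ⟨v, hv, hc, rfl⟩
    refine ⟨point hB hnd v hv, ?_, ax_of_ne_zero η hB hnd hv⟩
    rw [act_point hσ, point_inj, hc]

variable [DecidableEq V] [CharZero F]

theorem ax_mul_ax_eq_zero_iff (hη : η ≠ 0) {v w : V} (hv : v ≠ 0) (hw : w ≠ 0) (hvw : v ≠ w) :
    ax η hB hnd v * ax η hB hnd w = 0 ↔ B v w = 0 := by
  rw [ax_mul_ax, if_neg hvw]
  refine ⟨fun h => ?_, fun h => if_pos h⟩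
  by_contra h0
  rw [if_neg h0] at h
  have h1 := congrFun (congrArg (coords η hB hnd) h) v
  rw [map_zero, map_smul, map_sub, map_add, Pi.smul_apply, Pi.sub_apply, Pi.add_apply,
    coords_ax, coords_ax, coords_ax] at h1
  simp [hv, hvw.symm, hw, hη] at h1

theorem mem_doubles_iff (hη : η ≠ 0) (hσ : σ.toMulAut = MulAut.conj t)
    (hz : ∀ v, B ((t : V ≃ₗ[ZMod 2] V) v) v = B v z)
    (x : MatsuoAlgebra η (threeTranspositionGroup hB hnd)) :
    x ∈ doubles η σ ↔ ∃ v, v ≠ 0 ∧ (t : V ≃ₗ[ZMod 2] V) v ≠ v ∧ B v z = 0 ∧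
      x = ax η hB hnd v + ax η hB hnd ((t : V ≃ₗ[ZMod 2] V) v) := by
  constructor
  · rintro ⟨c, hc, h0, rfl⟩
    obtain ⟨v, hv, rfl⟩ := exists_eq_point hB hnd c
    rw [axis_act hσ, ← ax_of_ne_zero] at h0 ⊢
    rw [act_point hσ, Ne, point_inj] at hc
    rw [ax_mul_ax_eq_zero_iff hη hv ((LinearEquiv.map_ne_zero_iff _).mpr hv) (Ne.symm hc),
      symm_of_alt hB, hz] at h0
    exact ⟨v, hv, hc, h0, rfl⟩
  · rintro ⟨v, hv, hc, h0, rfl⟩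
    refine ⟨point hB hnd v hv, ?_, ?_, ?_⟩
    · rwa [act_point hσ, Ne, point_inj]
    · rwa [axis_act hσ, ← ax_of_ne_zero, ax_mul_ax_eq_zero_iff hη hv
        ((LinearEquiv.map_ne_zero_iff _).mpr hv) (Ne.symm hc), symm_of_alt hB, hz]
    · rw [axis_act hσ, ← ax_of_ne_zero]

variable [Fintype V]

theorem coords_ax_mul_ax_isometry (t : Sp B) (v w u : V) :
    coords η hB hnd (ax η hB hnd ((t : V ≃ₗ[ZMod 2] V) v) * ax η hB hnd ((t : V ≃ₗ[ZMod 2] V) w))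
      ((t : V ≃ₗ[ZMod 2] V) u) = coords η hB hnd (ax η hB hnd v * ax η hB hnd w) u := by
  have h : ∀ v, coords η hB hnd (ax η hB hnd ((t : V ≃ₗ[ZMod 2] V) v)) ((t : V ≃ₗ[ZMod 2] V) u) =
      coords η hB hnd (ax η hB hnd v) u := fun v => by
    simp only [coords_ax, EmbeddingLike.apply_eq_iff_eq, EmbeddingLike.map_eq_zero_iff]
  rw [ax_mul_ax, ax_mul_ax, ← map_add, t.2 v w]
  simp only [EmbeddingLike.apply_eq_iff_eq]
  split_ifs
  · exact h v
  · simp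
  · simp only [map_smul, map_sub, map_add, Pi.smul_apply, Pi.sub_apply, Pi.add_apply] at h ⊢
    rw [h, h, ← map_add, h]

variable (η hB hnd z) in
/-- The elements supported on `z⊥` and fixed by the isometry `t`. -/
noncomputable def fixedSubalgebra (t : Sp B) :
    NonUnitalSubalgebra F (MatsuoAlgebra η (threeTranspositionGroup hB hnd)) where
  carrier := {x | (∀ v, B v z ≠ 0 → coords η hB hnd x v = 0) ∧
    ∀ v, coords η hB hnd x ((t : V ≃ₗ[ZMod 2] V) v) = coords η hB hnd x v}
  zero_mem' := by simp
  add_mem' := by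
    rintro x y ⟨hx, hx'⟩ ⟨hy, hy'⟩
    exact ⟨fun v hv => by simp [hx v hv, hy v hv], fun v => by simp [hx', hy']⟩
  smul_mem' := by
    rintro a x ⟨hx, hx'⟩
    exact ⟨fun v hv => by simp [hx v hv], fun v => by simp [hx']⟩
  mul_mem' := by
    rintro x y ⟨hx, hx'⟩ ⟨hy, hy'⟩
    refine ⟨fun u hu => ?_, fun u => ?_⟩
    · rw [coords_mul]
      refine Finset.sum_eq_zero fun v _ => Finset.sum_eq_zero fun w _ => ?_
      by_cases hv : B v z = 0
      · by_cases hw : B w z = 0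
        · have h1 : v ≠ u := by rintro rfl; exact hu hv
          have h2 : w ≠ u := by rintro rfl; exact hu hw
          have h3 : v + w ≠ u := by rintro rfl; exact hu (by simp [hv, hw])
          rw [ax_mul_ax]
          split_ifs <;> simp [coords_ax, h1, h2, h3]
        · rw [hy w hw, mul_zero, zero_mul]
      · rw [hx v hv, zero_mul, zero_mul]
    · rw [coords_mul, coords_mul, ← Equiv.sum_comp (t : V ≃ₗ[ZMod 2] V).toEquiv]
      refine Finset.sum_congr rfl fun v _ => ?_
      rw [← Equiv.sum_comp (t : V ≃ₗ[ZMod 2] V).toEquiv]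
      refine Finset.sum_congr rfl fun w _ => ?_
      change coords η hB hnd x ((t : V ≃ₗ[ZMod 2] V) v) *
        coords η hB hnd y ((t : V ≃ₗ[ZMod 2] V) w) * coords η hB hnd
        (ax η hB hnd ((t : V ≃ₗ[ZMod 2] V) v) * ax η hB hnd ((t : V ≃ₗ[ZMod 2] V) w))
        ((t : V ≃ₗ[ZMod 2] V) u) = _
      rw [coords_ax_mul_ax_isometry, hx', hy']

theorem ax_add_ax_mem_fixedSubalgebra (htt : Function.Involutive (t : V ≃ₗ[ZMod 2] V))
    (htz : (t : V ≃ₗ[ZMod 2] V) z = z) {v : V} (hv : B v z = 0) :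
    ax η hB hnd v + ax η hB hnd ((t : V ≃ₗ[ZMod 2] V) v) ∈ fixedSubalgebra η hB hnd z t := by
  refine ⟨fun u hu => ?_, fun u => ?_⟩
  · have h1 : v ≠ u := by rintro rfl; exact hu hv
    have h2 : (t : V ≃ₗ[ZMod 2] V) v ≠ u := by
      rintro rfl
      rw [← htz, t.2] at hu
      exact hu hv
    simp [coords_ax, h1, h2]
  · have h : v = (t : V ≃ₗ[ZMod 2] V) u ↔ (t : V ≃ₗ[ZMod 2] V) v = u :=
      ⟨fun h => h ▸ htt u, fun h => h ▸ (htt v).symm⟩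
    simp only [map_add, Pi.add_apply, coords_ax, h, EmbeddingLike.apply_eq_iff_eq,
      EmbeddingLike.map_eq_zero_iff]
    exact add_comm _ _

theorem half_add_self (x : MatsuoAlgebra η (threeTranspositionGroup hB hnd)) :
    (2⁻¹ : F) • (x + x) = x := by
  rw [← two_smul F x, smul_smul, inv_mul_cancel₀ two_ne_zero, one_smul]

theorem fixed_mem_perp (hB : B.IsAlt) (hz : ∀ v, B ((t : V ≃ₗ[ZMod 2] V) v) v = B v z) {v : V}
    (hv : (t : V ≃ₗ[ZMod 2] V) v = v) : B v z = 0 := by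
  rw [← hz, hv, hB v]

/-- Singles and doubles already span: symmetrising an invariant element writes it as a combination
of `ax v + ax (t v)` with `v` in `z⊥`, each being zero, twice a single, or a double. So no products
are needed. -/
theorem flipSubalgebra_eq (hη : η ≠ 0) (hσ : σ.toMulAut = MulAut.conj t)
    (htt : Function.Involutive (t : V ≃ₗ[ZMod 2] V)) (htz : (t : V ≃ₗ[ZMod 2] V) z = z)
    (hz : ∀ v, B ((t : V ≃ₗ[ZMod 2] V) v) v = B v z) :
    flipSubalgebra η σ = fixedSubalgebra η hB hnd z t := by
  apply le_antisymm
  · refine NonUnitalAlgebra.adjoin_le ?_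
    rintro x (hx | hx)
    · obtain ⟨v, hv, hc, rfl⟩ := (mem_singles_iff hσ x).mp hx
      have h := ax_add_ax_mem_fixedSubalgebra (η := η) (hB := hB) (hnd := hnd) htt htz
        (fixed_mem_perp hB hz hc)
      rw [hc] at h
      rw [← half_add_self (ax η hB hnd v)]
      exact SMulMemClass.smul_mem _ h
    · obtain ⟨v, hv, hc, h0, rfl⟩ := (mem_doubles_iff hη hσ hz x).mp hx
      exact ax_add_ax_mem_fixedSubalgebra htt htz h0
  · intro x hx
    have h1 : x = (2⁻¹ : F) • ∑ v, coords η hB hnd x v •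
        (ax η hB hnd v + ax η hB hnd ((t : V ≃ₗ[ZMod 2] V) v)) := by
      conv_lhs => rw [← half_add_self x]
      congr 1
      simp only [smul_add, Finset.sum_add_distrib, sum_coords]
      congr 1
      conv_lhs => rw [← sum_coords x, ← Equiv.sum_comp (t : V ≃ₗ[ZMod 2] V).toEquiv]
      refine Finset.sum_congr rfl fun v _ => ?_
      change coords η hB hnd x ((t : V ≃ₗ[ZMod 2] V) v) • _ = _
      rw [hx.2]
      rfl
    rw [h1]
    refine SMulMemClass.smul_mem _ (sum_mem fun v _ => ?_)
    by_cases hv : B v z = 0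
    · refine SMulMemClass.smul_mem _ ?_
      by_cases hv0 : v = 0
      · rw [hv0, map_zero, ax_zero, add_zero]
        exact zero_mem _
      by_cases hc : (t : V ≃ₗ[ZMod 2] V) v = v
      · have : ax η hB hnd v ∈ flipSubalgebra η σ := NonUnitalAlgebra.subset_adjoin F
          (Or.inl ((mem_singles_iff hσ _).mpr ⟨v, hv0, hc, rfl⟩))
        rw [hc]
        exact add_mem this this
      · exact NonUnitalAlgebra.subset_adjoin F
          (Or.inr ((mem_doubles_iff hη hσ hz _).mpr ⟨v, hv0, hc, hv, rfl⟩))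
    · rw [hx.1 v hv, zero_smul]
      exact zero_mem _

theorem form_ax_isometry (t : Sp B) {x : MatsuoAlgebra η (threeTranspositionGroup hB hnd)}
    (hx : ∀ v, coords η hB hnd x ((t : V ≃ₗ[ZMod 2] V) v) = coords η hB hnd x v) (v : V) :
    form η _ (ax η hB hnd ((t : V ≃ₗ[ZMod 2] V) v)) x = form η _ (ax η hB hnd v) x := by
  rw [form_ax_apply, form_ax_apply, ← Equiv.sum_comp (t : V ≃ₗ[ZMod 2] V).toEquiv]
  refine Finset.sum_congr rfl fun w _ => ?_
  change coords η hB hnd x ((t : V ≃ₗ[ZMod 2] V) w) * form η _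
    (ax η hB hnd ((t : V ≃ₗ[ZMod 2] V) v)) (ax η hB hnd ((t : V ≃ₗ[ZMod 2] V) w)) = _
  rw [hx, form_ax_ax, form_ax_ax, t.2]
  simp only [EmbeddingLike.apply_eq_iff_eq, EmbeddingLike.map_eq_zero_iff]

/-- Pairing an invariant `x` with `ax v + ax (t v)` gives twice its pairing with `ax v`, so
orthogonality may be tested on single axes from `z⊥`. -/
theorem mem_radical_iff (htt : Function.Involutive (t : V ≃ₗ[ZMod 2] V))
    (htz : (t : V ≃ₗ[ZMod 2] V) z = z) (x : MatsuoAlgebra η (threeTranspositionGroup hB hnd)) :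
    x ∈ radical η _ (fixedSubalgebra η hB hnd z t).toSubmodule ↔
      x ∈ fixedSubalgebra η hB hnd z t ∧ ∀ v, B v z = 0 → form η _ (ax η hB hnd v) x = 0 := by
  refine and_congr_right fun hx => ⟨fun h v hv => ?_, fun h a ha => ?_⟩
  · have h1 : form η _ (ax η hB hnd v + ax η hB hnd ((t : V ≃ₗ[ZMod 2] V) v)) x = 0 :=
      h _ (ax_add_ax_mem_fixedSubalgebra htt htz hv)
    rw [map_add, LinearMap.add_apply, form_ax_isometry t hx.2, ← two_mul] at h1
    exact (mul_eq_zero.mp h1).resolve_left two_ne_zero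
  · change form η _ a x = 0
    rw [← sum_coords a, map_sum, LinearMap.sum_apply]
    refine Finset.sum_eq_zero fun v _ => ?_
    rw [map_smul, LinearMap.smul_apply]
    by_cases hv : B v z = 0
    · rw [h v hv, smul_zero]
    · rw [ha.1 v hv, zero_smul]

theorem map_coords_radical (htt : Function.Involutive (t : V ≃ₗ[ZMod 2] V))
    (htz : (t : V ≃ₗ[ZMod 2] V) z = z) :
    (radical η _ (fixedSubalgebra η hB hnd z t).toSubmodule).map (coords η hB hnd) =
      radFunctions B z (t : V ≃ₗ[ZMod 2] V).toLinearMap η := by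
  have hsupp : ∀ f : V → F, (∀ v, B v z ≠ 0 → f v = 0) ↔ ∀ v, ind F B z v * f v = f v := by
    refine fun f => forall_congr' fun v => ?_
    unfold ind
    by_cases h : B v z = 0
    · simp [h]
    · simp [h, eq_comm]
  ext f
  rw [Submodule.mem_map]
  constructor
  · rintro ⟨x, hx, rfl⟩
    obtain ⟨⟨h1, h2⟩, h3⟩ := (mem_radical_iff htt htz x).mp hx
    refine ⟨coords_zero_apply x, (hsupp _).mp h1, h2, fun v hv => ?_⟩
    by_cases hv0 : v = 0
    · simp [hv0, coords_zero_apply]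
    · rw [← form_ax_eq hv0, h3 v hv]
  · rintro ⟨h0, h1, h2, h3⟩
    refine ⟨∑ v, f v • ax η hB hnd v, (mem_radical_iff htt htz _).mpr ⟨⟨?_, ?_⟩, fun v hv => ?_⟩,
      coords_sum h0⟩
    · rw [coords_sum h0]; exact (hsupp f).mpr h1
    · rw [coords_sum h0]; exact h2
    · by_cases hv0 : v = 0
      · rw [hv0, ax_zero, map_zero, LinearMap.zero_apply]
      · rw [form_ax_eq hv0, coords_sum h0, h3 v hv]

theorem finrank_radical (htt : Function.Involutive (t : V ≃ₗ[ZMod 2] V))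
    (htz : (t : V ≃ₗ[ZMod 2] V) z = z) :
    finrank F (radical η _ (fixedSubalgebra η hB hnd z t).toSubmodule) =
      finrank F (radFunctions B z (t : V ≃ₗ[ZMod 2] V).toLinearMap η) := by
  rw [← map_coords_radical (hB := hB) (hnd := hnd) htt htz]
  exact (Submodule.equivMapOfInjective _ coords_injective _).finrank_eq

end Symplectic

/-! ### Axis polynomials and the axial radical -/

namespace Symplectic

open MatsuoAlgebra SymplecticFunctions

variable {F : Type*} [Field F] {η : F} {V : Type*} [AddCommGroup V] [Module (ZMod 2) V]
  {B : LinearMap.BilinForm (ZMod 2) V} [FiniteDimensional (ZMod 2) V] {hB : B.IsAlt}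
  {hnd : B.Nondegenerate} {σ : (threeTranspositionGroup hB hnd).Flip} {t : Sp B}
  {z : V} [DecidableEq V]

theorem ax_mul_self (v : V) : ax η hB hnd v * ax η hB hnd v = ax η hB hnd v := by
  rw [ax_mul_ax, if_pos rfl]

theorem ax_mul_ax_of_form_eq_zero {v w : V} (hvw : v ≠ w) (h : B v w = 0) :
    ax η hB hnd v * ax η hB hnd w = 0 := by
  rw [ax_mul_ax, if_neg hvw, if_pos h]

theorem ax_mul_ax_of_form_eq_one {v w : V} (h : B v w = 1) : ax η hB hnd v * ax η hB hnd w =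
    (η / 2) • (ax η hB hnd v + ax η hB hnd w - ax η hB hnd (v + w)) := by
  have hvw : v ≠ w := by
    rintro rfl
    rw [hB v] at h
    exact zero_ne_one h
  rw [ax_mul_ax, if_neg hvw, if_neg (by rw [h]; exact one_ne_zero)]

theorem add_add_cancel_left (u v : V) : u + (u + v) = v := by
  rw [← add_assoc, add_self', zero_add]

theorem ne_of_form {u v w : V} (hv : B u v = 0) (hw : B u w = 1) : v ≠ w := by
  rintro rfl
  rw [hv] at hw
  exact zero_ne_one hw

/-- The polynomial `X (X - η)` kills the eigenspaces of an axis for `0` and `η` and takes the value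
`1 - η` at the eigenvalue `1`, leaving the component along the axis. -/
theorem ax_mul_ax_mul_self [CharZero F] {v : V} (hv : v ≠ 0)
    (u : MatsuoAlgebra η (threeTranspositionGroup hB hnd)) :
    ax η hB hnd v * (ax η hB hnd v * u) = η • (ax η hB hnd v * u) +
      ((1 - η) * form η _ (ax η hB hnd v) u) • ax η hB hnd v := by
  induction u using ax_induction with
  | add x y hx hy =>
    rw [mul_add, mul_add, hx, hy, map_add]
    module
  | smul a x hx =>
    rw [mul_smul_comm, mul_smul_comm, hx, map_smul, smul_eq_mul]
    module
  | ax w =>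
    rw [form_ax_ax, if_neg hv]
    by_cases hvw : v = w
    · subst hvw
      rw [ax_mul_self, ax_mul_self, if_pos rfl]
      module
    rw [if_neg hvw]
    rcases zmod_cases (B v w) with h | h
    · rw [ax_mul_ax_of_form_eq_zero hvw h, if_pos h]
      simp
    · have h1 : B v (v + w) = 1 := by rw [map_add, hB v, h, zero_add]
      rw [ax_mul_ax_of_form_eq_one h, if_neg (by rw [h]; exact one_ne_zero), mul_smul_comm,
        mul_sub, mul_add, ax_mul_self, ax_mul_ax_of_form_eq_one h, ax_mul_ax_of_form_eq_one h1,
        add_add_cancel_left]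
      module

theorem ax_mul_mul_eq_zero {v v' w : V} (hvv : v ≠ v') (h : B v v' = 0) (hvw : v ≠ w)
    (hw : B v w = 0) (hw' : v' ≠ w) :
    ax η hB hnd v * (ax η hB hnd v' * ax η hB hnd w) = 0 := by
  rcases zmod_cases (B v' w) with h' | h'
  · rw [ax_mul_ax_of_form_eq_zero hw' h', mul_zero]
  · have h1 : v ≠ v' + w := ne_of_form (u := v') (by rw [symm_of_alt hB, h])
      (by rw [map_add, hB v', h', zero_add])
    rw [ax_mul_ax_of_form_eq_one h', mul_smul_comm, mul_sub, mul_add,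
      ax_mul_ax_of_form_eq_zero hvv h, ax_mul_ax_of_form_eq_zero hvw hw,
      ax_mul_ax_of_form_eq_zero h1 (by rw [map_add, h, hw, add_zero])]
    simp

theorem ax_mul_mul_of_form_eq_one {v v' w : V} (hvv : v ≠ v') (h : B v v' = 0)
    (hw : B v w = 1) (hw' : B v' w = 1) :
    ax η hB hnd v * (ax η hB hnd v' * ax η hB hnd w) = (η / 2 * (η / 2)) •
      (ax η hB hnd w - ax η hB hnd (v + w) - ax η hB hnd (v' + w) +
        ax η hB hnd (v + (v' + w))) := by
  rw [ax_mul_ax_of_form_eq_one hw', mul_smul_comm, mul_sub, mul_add,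
    ax_mul_ax_of_form_eq_zero hvv h, ax_mul_ax_of_form_eq_one hw,
    ax_mul_ax_of_form_eq_one (by rw [map_add, h, hw, zero_add])]
  module

/-- On an axis `ax w` other than the given two, both sides vanish unless `(v, w) = (v', w) = 1`;
then the double product is symmetric in `v` and `v'`. -/
theorem ax_mul_left_comm {v v' : V} (hvv : v ≠ v') (h : B v v' = 0)
    (u : MatsuoAlgebra η (threeTranspositionGroup hB hnd)) :
    ax η hB hnd v * (ax η hB hnd v' * u) = ax η hB hnd v' * (ax η hB hnd v * u) := by
  have h' : B v' v = 0 := by rw [symm_of_alt hB, h]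
  induction u using ax_induction with
  | add x y hx hy => simp only [mul_add, hx, hy]
  | smul a x hx => simp only [mul_smul_comm, hx]
  | ax w =>
    by_cases hw : v = w
    · subst hw
      rw [ax_mul_self, ax_mul_ax_of_form_eq_zero hvv.symm h', mul_zero]
    by_cases hw' : v' = w
    · subst hw'
      rw [ax_mul_self, ax_mul_ax_of_form_eq_zero hvv h, mul_zero]
    rcases zmod_cases (B v w) with h1 | h1
    · rw [ax_mul_mul_eq_zero hvv h hw h1 hw', ax_mul_ax_of_form_eq_zero hw h1, mul_zero]
    rcases zmod_cases (B v' w) with h2 | h2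
    · rw [ax_mul_mul_eq_zero hvv.symm h' hw' h2 hw, ax_mul_ax_of_form_eq_zero hw' h2, mul_zero]
    · rw [ax_mul_mul_of_form_eq_one hvv h h1 h2, ax_mul_mul_of_form_eq_one hvv.symm h' h2 h1,
        add_left_comm v v']
      module

/-- The polynomial `X (X - η) (X - 2η)` in the multiplication by a double projects to the
span of its two axes. -/
theorem double_mul_mul_mul [CharZero F] [Fintype V] {v v' : V} (hv : v ≠ 0) (hv' : v' ≠ 0)
    (hvv : v ≠ v') (h : B v v' = 0) {d u : MatsuoAlgebra η (threeTranspositionGroup hB hnd)}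
    (hd : d = ax η hB hnd v + ax η hB hnd v') :
    d * (d * (d * u)) - (3 * η) • (d * (d * u)) + (2 * η ^ 2) • (d * u) =
      ((1 - η) * (1 - 2 * η) * form η _ (ax η hB hnd v) u) • ax η hB hnd v +
      ((1 - η) * (1 - 2 * η) * form η _ (ax η hB hnd v') u) • ax η hB hnd v' := by
  set a := ax η hB hnd v with ha
  set b := ax η hB hnd v' with hb
  have haa : ∀ u, a * (a * u) = η • (a * u) + ((1 - η) * form η _ a u) • a :=
    ax_mul_ax_mul_self hv
  have hbb : ∀ u, b * (b * u) = η • (b * u) + ((1 - η) * form η _ b u) • b :=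
    ax_mul_ax_mul_self hv'
  have hba : ∀ u, b * (a * u) = a * (b * u) := fun u => (ax_mul_left_comm hvv h u).symm
  have hab0 : a * b = 0 := ax_mul_ax_of_form_eq_zero hvv h
  have hba0 : b * a = 0 := ax_mul_ax_of_form_eq_zero hvv.symm (by rw [symm_of_alt hB, h])
  have ha2 : a * a = a := ax_mul_self v
  have hb2 : b * b = b := ax_mul_self v'
  have e1 : form η _ a (b * u) = 0 := by rw [← form_mul, hab0, map_zero, LinearMap.zero_apply]
  subst hd
  simp only [add_mul, mul_add, haa, hbb, hba, mul_smul_comm, ha2, hb2, hab0, hba0, e1, smul_zero,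
    mul_zero, zero_smul, add_zero, zero_add]
  module

variable [CharZero F] [Fintype V]

theorem isIdealOf_radical (A : NonUnitalSubalgebra F
    (MatsuoAlgebra η (threeTranspositionGroup hB hnd))) :
    IsIdealOf A (radical η _ A.toSubmodule) := by
  refine ⟨inf_le_left, fun a ha u hu => ?_⟩
  have h : a * u ∈ radical η _ A.toSubmodule := by
    refine ⟨A.mul_mem ha hu.1, fun b hb => ?_⟩
    change form η _ b (a * u) = 0
    rw [← form_mul]
    exact hu.2 _ (A.mul_mem hb ha)
  exact ⟨h, mul_comm' a u ▸ h⟩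

/-- If some `u` in an ideal pairs nontrivially with an axis from `z⊥`, the axis polynomial applied
to `u` puts the corresponding single or double into the ideal. The factors `1 - η` and `1 - 2η` must
be invertible for this. -/
theorem isAxialRadical_radical (hη : η ≠ 0) (hη1 : η ≠ 1) (hη2 : η ≠ 1 / 2)
    (hσ : σ.toMulAut = MulAut.conj t) (htt : Function.Involutive (t : V ≃ₗ[ZMod 2] V))
    (htz : (t : V ≃ₗ[ZMod 2] V) z = z)
    (hz : ∀ v, B ((t : V ≃ₗ[ZMod 2] V) v) v = B v z) :
    IsAxialRadical (flipSubalgebra η σ) (singles η σ ∪ doubles η σ)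
      (radical η _ (flipSubalgebra η σ).toSubmodule) := by
  have h1η : (1 - η) ≠ 0 := sub_ne_zero.mpr (Ne.symm hη1)
  have h2η : (1 - 2 * η) ≠ 0 := fun h => hη2 (by linear_combination -h / 2)
  have hsub : singles η σ ∪ doubles η σ ⊆ flipSubalgebra η σ := NonUnitalAlgebra.subset_adjoin F
  have hA := flipSubalgebra_eq (η := η) hη hσ htt htz hz
  refine ⟨⟨isIdealOf_radical _, fun x hx hR => ?_⟩, fun I ⟨hI, hIx⟩ u hu => ?_⟩
  · have hform : form η _ x x = 0 := hR.2 x (hsub hx)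
    rcases hx with hx | hx
    · obtain ⟨v, hv, -, rfl⟩ := (mem_singles_iff hσ x).mp hx
      rw [form_ax_ax, if_pos rfl, if_neg hv] at hform
      exact one_ne_zero hform
    · obtain ⟨v, hv, hc, h0, rfl⟩ := (mem_doubles_iff hη hσ hz x).mp hx
      rw [← hz] at h0
      have h0' : B v ((t : V ≃ₗ[ZMod 2] V) v) = 0 := by rw [symm_of_alt hB, h0]
      simp [form_ax_ax, hv, hc, Ne.symm hc, h0, h0'] at hform
  · rw [hA, mem_radical_iff htt htz, ← hA]
    have huA : u ∈ flipSubalgebra η σ := hI.1 hu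
    refine ⟨huA, fun v hv => ?_⟩
    by_cases hv0 : v = 0
    · rw [hv0, ax_zero, map_zero, LinearMap.zero_apply]
    by_contra hne
    by_cases hc : (t : V ≃ₗ[ZMod 2] V) v = v
    · have hs : ax η hB hnd v ∈ singles η σ := (mem_singles_iff hσ _).mpr ⟨v, hv0, hc, rfl⟩
      have hsA := hsub (Or.inl hs)
      refine hIx _ (Or.inl hs) ?_
      have h1 := (hI.2 _ hsA u hu).1
      have h2 := (hI.2 _ hsA _ h1).1
      rw [ax_mul_ax_mul_self hv0, Submodule.add_mem_iff_right _ (I.smul_mem _ h1)] at h2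
      exact (I.smul_mem_iff (mul_ne_zero h1η hne)).mp h2
    · have hs : ax η hB hnd v + ax η hB hnd ((t : V ≃ₗ[ZMod 2] V) v) ∈ doubles η σ :=
        (mem_doubles_iff hη hσ hz _).mpr ⟨v, hv0, hc, hv, rfl⟩
      have hsA := hsub (Or.inr hs)
      refine hIx _ (Or.inr hs) ?_
      have h1 := (hI.2 _ hsA u hu).1
      have h2 := (hI.2 _ hsA _ h1).1
      have h3 := (hI.2 _ hsA _ h2).1
      have h4 := I.add_mem (I.sub_mem h3 (I.smul_mem (3 * η) h2)) (I.smul_mem (2 * η ^ 2) h1)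
      -- Invariance of `u` makes the coefficients of the two axes equal, so the result is a multiple
      -- of the double itself.
      rw [double_mul_mul_mul hv0 ((LinearEquiv.map_ne_zero_iff _).mpr hv0) (Ne.symm hc)
        (by rw [symm_of_alt hB, hz, hv]) rfl, form_ax_isometry t (hA ▸ huA).2, ← smul_add] at h4
      exact (I.smul_mem_iff (mul_ne_zero (mul_ne_zero h1η h2η) hne)).mp h4

end Symplectic

/-! ### The dimension formula and the main theorem -/

namespace Symplectic

open MatsuoAlgebra SymplecticFunctions

variable {F : Type*} [Field F] [CharZero F] {η : F} {V : Type*} [AddCommGroup V]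
  [Module (ZMod 2) V] [FiniteDimensional (ZMod 2) V] [Fintype V] [DecidableEq V]
  {B : LinearMap.BilinForm (ZMod 2) V}

theorem finrank_radFunctions_tau {m : ℕ} (hm : 0 < m) (hV : finrank (ZMod 2) V = 2 * m)
    (hB : B.IsAlt) (hnd : B.Nondegenerate) {e : Fin m → V} (he : ∀ i j, B (e i) (e j) = 0)
    (hli : LinearIndependent (ZMod 2) e) {c : F} (hc : c ^ 2 = 2 ^ (2 * m)) (hηc : η * c = 4)
    (hc2 : c ≠ -2) :
    (finrank F (radFunctions B (∑ i, e i) (tau hB e : V ≃ₗ[ZMod 2] V).toLinearMap η) : F) + 1 =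
      (2 ^ (2 * m) / 2 + 2 ^ m + if Odd m then 0 else 2 ^ m) / 8 + c / 4 := by
  have hcard : Fintype.card V = 2 ^ (2 * m) := by
    rw [Module.card_eq_pow_finrank (K := ZMod 2), hV, ZMod.card]
  have hcV : c ^ 2 = (Fintype.card V : F) := by rw [hc, hcard]; push_cast; rfl
  have hz := sum_ne_zero_of_linearIndependent hm hli
  have h1 := finrank_radFunctions_add_one (τ := (tau hB e : V ≃ₗ[ZMod 2] V).toLinearMap)
    hnd hB hz (tau hB e).2 (tau_involutive hB he) (tau_sum hB he) hcV hηc hc2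
  have h2 := finrank_eigenFunctions (τ := (tau hB e : V ≃ₗ[ZMod 2] V).toLinearMap)
    hnd hB hz (tau hB e).2 (tau_involutive hB he) (tau_sum hB he) (form_tau_self hB he) hcV
  simp only [LinearEquiv.coe_coe] at h1 h2 ⊢
  rw [card_fixed hV hB hnd he hli, card_translated hV hB hnd he hli, ← h1, hc] at h2
  push_cast at h2
  exact h2

end Symplectic

theorem mainTheorem10 {F : Type*} [Field F] [CharZero F] (η : F) (hη0 : η ≠ 0) (hη1 : η ≠ 1)
    (m : ℕ) (hm : 2 ≤ m)
    {V : Type*} [AddCommGroup V] [Module (ZMod 2) V] [FiniteDimensional (ZMod 2) V]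
    (hV : Module.finrank (ZMod 2) V = 2 * m)
    (B : LinearMap.BilinForm (ZMod 2) V) (hB : B.IsAlt) (hnd : B.Nondegenerate)
    (e : Fin m → V) (he : ∀ i j, B (e i) (e j) = 0) (hli : LinearIndependent (ZMod 2) e) :
    let σ := Symplectic.tauFlip hB hnd (by omega) e he hli
    let A := MatsuoAlgebra.flipSubalgebra η σ
    let R := MatsuoAlgebra.radical η _ A.toSubmodule
    -- the flip is of type 1 and rank m
    (Symplectic.IsTypeOne (Symplectic.tau hB e) ∧ Symplectic.flipRank (Symplectic.tau hB e) = m) ∧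
    -- the radical of the form on `A` is the radical of the axial algebra `A`
    (η ≠ 1 / 2 →
      IsAxialRadical A (MatsuoAlgebra.singles η σ ∪ MatsuoAlgebra.doubles η σ) R) ∧
    -- critical values
    (R ≠ ⊥ ↔ η = -1 / 2 ^ (2 * m - 3) ∨ (η = -1 / 2 ^ (m - 2) ∧ m ≠ 2) ∨ η = 1 / 2 ^ (m - 2)) ∧
    -- dimensions
    (η = -1 / 2 ^ (2 * m - 3) → Module.finrank F R = 1) ∧
    (η = -1 / 2 ^ (m - 2) → (Module.finrank F R : ℤ) =
      if Odd m then 2 ^ (2 * m - 4) - 2 ^ (m - 3) - 1 else 2 ^ (2 * m - 4) - 1) ∧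
    (η = 1 / 2 ^ (m - 2) → (Module.finrank F R : ℤ) =
      if Odd m then 2 ^ (2 * m - 4) + 3 * 2 ^ (m - 3) - 1
      else 2 ^ (2 * m - 4) + 2 ^ (m - 1) - 1) := by
  classical
  -- Writing `m = k + 2` removes every truncated subtraction from the exponents except `m - 3`.
  obtain ⟨k, rfl⟩ := Nat.exists_eq_add_of_le' hm
  have : Finite V := Module.finite_of_finite (ZMod 2)
  have := Fintype.ofFinite V
  have hcard : Fintype.card V = 2 ^ (2 * (k + 2)) := by
    rw [Module.card_eq_pow_finrank (K := ZMod 2), hV, ZMod.card]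
  have hcardF : (Fintype.card V : F) = 2 ^ (2 * (k + 2)) := by rw [hcard]; push_cast; rfl
  have hz := Symplectic.sum_ne_zero_of_linearIndependent (by omega) hli
  have htt := Symplectic.tau_involutive hB he
  have htz := Symplectic.tau_sum hB he
  have htB := Symplectic.form_tau_self hB he
  set t := Symplectic.tau hB e with ht
  set z := ∑ i, e i with hzdef
  intro σ A R
  have hσ : σ.toMulAut = MulAut.conj t := rfl
  have hR : R = MatsuoAlgebra.radical η _ (Symplectic.fixedSubalgebra η hB hnd z t).toSubmodule := by
    rw [← Symplectic.flipSubalgebra_eq hη0 hσ htt htz htB]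
  set S := SymplecticFunctions.radFunctions B z (t : V ≃ₗ[ZMod 2] V).toLinearMap η with hS
  have hfin : finrank F R = finrank F S := by rw [hR, Symplectic.finrank_radical htt htz]
  have hbot : R = ⊥ ↔ S = ⊥ := by
    rw [hS, ← Symplectic.map_coords_radical (hB := hB) (hnd := hnd) htt htz, ← hR,
      ← (Submodule.map_injective_of_injective (Symplectic.coords_injective (η := η))).eq_iff,
      Submodule.map_bot]
  have h2 : ∀ n : ℕ, (2 : F) ^ n ≠ 0 := fun n => pow_ne_zero n two_ne_zero
  have e1 : 2 * (k + 2) - 3 = 2 * k + 1 := by omega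
  have e2 : k + 2 - 2 = k := by omega
  have e3 : 2 * (k + 2) - 4 = 2 * k := by omega
  have e4 : k + 2 - 1 = k + 1 := by omega
  rw [e1, e2, e3, e4]
  have dim1 : η = -1 / 2 ^ (2 * k + 1) → finrank F R = 1 := by
    intro h
    rw [hfin]
    refine SymplecticFunctions.finrank_radFunctions_eq_one hnd hB hz t.2 htt htz ?_ ?_
    · rw [hcardF, h, show 2 * (k + 2) = 2 * k + 1 + 3 by ring, pow_add]
      field_simp [h2]
      ring
    · rw [hcard]
      have : 2 ^ 4 ≤ 2 ^ (2 * (k + 2)) := Nat.pow_le_pow_right (by norm_num) (by omega)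
      omega
  -- The exponent `m - 3` truncates only at `m = 2`, which is even, so the odd branch of the
  -- formulas never sees it.
  have odd_exists : Odd (k + 2) → ∃ j, k = j + 1 := fun h =>
    Nat.exists_eq_succ_of_ne_zero (by rintro rfl; exact absurd h (by decide))
  have dim2 : η = -1 / 2 ^ k → (finrank F R : ℤ) =
      if Odd (k + 2) then 2 ^ (2 * k) - 2 ^ (k + 2 - 3) - 1 else 2 ^ (2 * k) - 1 := by
    intro h
    -- The relevant Fourier eigenvalue is `c = 4/η`, here `-2^m`; it differs from `-2` because `m ≥
    -- 2`.
    have key := Symplectic.finrank_radFunctions_tau (η := η) (c := -2 ^ (k + 2)) (by omega) hV hB hnd he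
      hli
      (by ring) (by rw [h, pow_add]; field_simp [h2]; norm_num) (by
        intro h
        have h' : (2 : F) ^ (k + 2) = 2 ^ 1 := by linear_combination -h
        have h'' : 2 ^ (k + 2) = 2 ^ 1 := by exact_mod_cast h'
        have := Nat.pow_right_injective le_rfl h''
        omega)
    rw [hfin]
    apply Int.cast_injective (α := F)
    rw [Int.cast_natCast, eq_sub_of_add_eq key]
    split_ifs with ho
    · obtain ⟨j, rfl⟩ := odd_exists ho
      rw [show j + 1 + 2 - 3 = j by omega]
      push_cast
      ring
    · push_cast
      ring
  have dim3 : η = 1 / 2 ^ k → (finrank F R : ℤ) =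
      if Odd (k + 2) then 2 ^ (2 * k) + 3 * 2 ^ (k + 2 - 3) - 1
      else 2 ^ (2 * k) + 2 ^ (k + 1) - 1 := by
    intro h
    have key := Symplectic.finrank_radFunctions_tau (η := η) (c := 2 ^ (k + 2)) (by omega) hV hB hnd he
      hli
      (by ring) (by rw [h, pow_add]; field_simp [h2]; norm_num) (by
        intro h
        have h' : (2 : F) ^ (k + 2) + 2 = 0 := by linear_combination h
        have h'' : 2 ^ (k + 2) + 2 = 0 := by exact_mod_cast h'
        exact absurd h'' (by positivity))
    rw [hfin]
    apply Int.cast_injective (α := F)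
    rw [Int.cast_natCast, eq_sub_of_add_eq key]
    split_ifs with ho
    · obtain ⟨j, rfl⟩ := odd_exists ho
      rw [show j + 1 + 2 - 3 = j by omega]
      push_cast
      ring
    · push_cast
      ring
  have hpos : (finrank F R : ℤ) ≠ 0 → R ≠ ⊥ := by
    intro h h0
    rw [h0, finrank_bot] at h
    exact h rfl
  refine ⟨⟨Symplectic.isTypeOne_tau (by omega) hB hnd he hli,
      Symplectic.flipRank_tau hV hB hnd he hli⟩,
    fun h => Symplectic.isAxialRadical_radical hη0 hη1 h hσ htt htz htB, ⟨fun h => ?_, ?_⟩,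
    dim1, dim2, dim3⟩
  · have hc := SymplecticFunctions.critical_of_radFunctions_ne_bot hnd hB hz hη0 (mt hbot.mpr h)
    rw [hcardF] at hc
    rcases hc with hc | hc
    · refine Or.inl ((eq_div_iff (h2 _)).mpr ?_)
      linear_combination hc / 8
    · have hc' : (η * 2 ^ k - 1) * (η * 2 ^ k + 1) = 0 := by linear_combination hc / 16
      rcases mul_eq_zero.mp hc' with hc' | hc'
      · exact Or.inr (Or.inr ((eq_div_iff (h2 _)).mpr (sub_eq_zero.mp hc')))
      -- For `m = 2` this is `η = -1`, where the dimension formula gives `0`; this is the exception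
      -- in the list of critical values.
      · have hη : η = -1 / 2 ^ k := (eq_div_iff (h2 _)).mpr (eq_neg_of_add_eq_zero_left hc')
        refine Or.inr (Or.inl ⟨hη, fun hk => h ?_⟩)
        obtain rfl : k = 0 := by omega
        have hd := dim2 hη
        rw [if_neg (by decide), hfin] at hd
        rw [hbot, ← Submodule.finrank_eq_zero (R := F)]
        simpa using hd
  · rintro (h | ⟨h, hk⟩ | h)
    · exact hpos (by rw [dim1 h]; norm_num)
    · refine hpos ?_
      rw [dim2 h]
      obtain ⟨j, rfl⟩ : ∃ j, k = j + 1 := Nat.exists_eq_succ_of_ne_zero (by omega)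
      have hj : (1 : ℤ) ≤ 2 ^ j := one_le_pow₀ (by norm_num)
      rw [show j + 1 + 2 - 3 = j by omega, show (2 : ℤ) ^ (2 * (j + 1)) = 4 * (2 ^ j * 2 ^ j) by
        ring]
      split_ifs <;> nlinarith
    · refine hpos ?_
      rw [dim3 h]
      have hj : (1 : ℤ) ≤ 2 ^ (2 * k) := one_le_pow₀ (by norm_num)
      have hj1 : (1 : ℤ) ≤ 2 ^ (k + 1) := one_le_pow₀ (by norm_num)
      have hj2 : (1 : ℤ) ≤ 2 ^ (k + 2 - 3) := one_le_pow₀ (by norm_num)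
      split_ifs <;> omega
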